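/- **Setting.** Let $X$ be a set and let $P(X)$ be the monoid of all partial transformations of $X$ (maps from a subset of $X$ to $X$), written on the right and composed from left to right; its zero $0$ is the transformation with empty domain. In a monoid $S$ with zero put $\mathbb P(0)=\{0\}$ and, for $a\neq 0$, $\mathbb P(a)=\{g\in S: (ma)g\ne 0 \text{ for all } m\in S \text{ with } ma\neq 0\}$; put $\mathbb P^1(a)=\mathbb P(a)\cup\{1\}$. Then $a\sim_c b$ means that there are $g\in\mathbb P^1(a)$ and $h\in\mathbb P^1(b)$ with $ag=gb$ and $bh=ha$. For $\alpha\in P(X)$ write $x\to y$ if $x\in\operatorname{dom}\alpha$ and $x\alpha=y$, and let $\operatorname{span}\alpha=\operatorname{dom}\alpha\cup\operatorname{im}\alpha$. Let the $x_i$ be pairwise distinct. A *cycle* of length $k\ge1$, a *right ray*, a *double ray*, a *left ray*, a *chain* of length $k\ge 1$ is an element of $P(X)$ whose arcs are exactly $x_0\to x_1\to\dots\to x_{k-1}\to x_0$; $x_0\to x_1\to x_2\to\cdots$; $\cdots\to x_{-1}\to x_0\to x_1\to\cdots$; $\cdots\to x_2\to x_1\to x_0$; $x_0\to x_1\to\dots\to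 x_k$, respectively. We say that $\alpha$ *has* (contains) $\mu\in P(X)$ if $\alpha$ extends $\mu$; such a basic transformation $\mu$ is *maximal* in $\alpha$ if every $x\in\operatorname{span}\mu$ satisfies: $x\notin\operatorname{dom}\mu\Rightarrow x\notin\operatorname{dom}\alpha$, and $x\notin\operatorname{im}\mu\Rightarrow x\notin\operatorname{im}\alpha$. $\gamma\in P(X)$ is *connected* if $\gamma\ne0$ and for all $x,y\in\operatorname{span}\gamma$ there are $k,m\ge0$ such that $x\gamma^k$ and $y\gamma^m$ are defined and equal. Each $\alpha$ is the join (union) of a unique set of connected transformations contained in $\alpha$ with pairwise disjoint spans; its members are the *connected components* of $\alpha$. A connected $\gamma$ has *type rro* if it has a maximal right ray but no cycles, double rays, left rays or maximal chains; it has *type cho* if it has a maximal chain but no cycles and no right, left or double rays. If $\gamma$ is of type cho, its *root* is the unique element of $\operatorname{span}\gamma\setminus\operatorname{dom}\gamma$. For $\gamma$ of type rro or cho the relation $y\to x$ is well founded, and $\rho_\gamma(x)=\sup\{\rho_\gamma(y)+1:\ y\gamma=x\}$ denotes the ordinal rank. For a maximal right ray $\eta=[x_0\,x_1\,x_2\dots\rangle$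 in $\gamma$ of type rro put $\eta^\gamma_n=\rho_\gamma(x_n)$. A sequence of ordinals $\langle b_n\rangle_{n\ge 0}$ *dominates* $\langle a_n\rangle_{n\ge 0}$ if there is $k\ge0$ with $b_{k+n}\ge a_n$ for all $n\ge0$. Let $M$ be the set of lengths of cycles in $\alpha$, i.e. of all $n\ge 1$ such that some $x\in\operatorname{dom}\alpha$ has $x\alpha^n=x$ and $x\alpha^i\neq x$ for $1\le i<n$. The *cycle set* $\mathrm{cs}(\alpha)$ is the standard antichain of $M$: the set of those $m\in M$ that are not multiples of any smaller element of $M$ (so $\mathrm{cs}(\alpha)=\emptyset$ if $\alpha$ has no cycles). **Theorem.** Let $\alpha,\beta\in P(X)$. Then $\alpha\sim_c\beta$ in $P(X)$ if and only if $\alpha=\beta=0$, or $\alpha,\beta\ne0$ and all of the following hold: 1. $\mathrm{cs}(\alpha)=\mathrm{cs}(\beta)$; 2. $\alpha$ has a double ray but not a cycle $\iff$ $\beta$ has a double ray but not a cycle; 3. (a) if $\alpha$ has no cycles or double rays, then for every connected component $\gamma$ of $\alpha$ of type rro: $\beta$ has no cycles or double rays and has a connected component $\delta$ of type rro such that $\langle\xi^\delta_n\rangle$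 dominates $\langle\eta^\gamma_n\rangle$ for some maximal right rays $\eta$ in $\gamma$ and $\xi$ in $\delta$; (b) the same with $\alpha$ and $\beta$ interchanged; 4. $\alpha$ has a maximal left ray $\iff$ $\beta$ has a maximal left ray; 5. (a) if $\alpha$ has no maximal left rays, then for every connected component $\gamma$ of $\alpha$ of type cho, with root $x_0$: $\beta$ has no maximal left rays and has a connected component $\delta$ of type cho, with root $y_0$, such that $\rho_\gamma(x_0)\le\rho_\delta(y_0)$; (b) the same with $\alpha$ and $\beta$ interchanged. -/

import Mathlib

/-- The set `P(X)` of partial transformations of `X`; `α x = none` means that `x` is not in the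
domain of `α`. -/
def PTrans (X : Type*) : Type _ := X → Option X

/-- The monoid with zero `P(X)`. Maps are written on the right and composed from left to right:
`α * β` means first `α`, then `β`. The zero is the transformation with empty domain. -/
instance PTrans.instMonoidWithZero {X : Type*} : MonoidWithZero (PTrans X) where
  mul α β := fun x => (α x).bind β
  one := fun x => some x
  zero := fun _ => none
  mul_assoc α β γ := funext fun x => Option.bind_assoc (α x) β γ
  one_mul _ := rfl
  mul_one α := funext fun x => Option.bind_fun_some (α x)
  zero_mul _ := rfl
  mul_zero α := funext fun x => Option.bind_fun_none (α x)

/-! ### Conjugacy in a monoid with zero -/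

/-- The set `ℙ(a)`: for `a ≠ 0`, all `g` with `(m a) g ≠ 0` for every nonzero element `m a` of the
left ideal `S a` (here `S¹ = S`, as `S` is a monoid); and `ℙ(0) = {0}`. -/
def conjP {S : Type*} [MonoidWithZero S] (a : S) : Set S :=
  {g | (a = 0 ∧ g = 0) ∨ (a ≠ 0 ∧ ∀ m : S, m * a ≠ 0 → (m * a) * g ≠ 0)}

/-- The set `ℙ¹(a) = ℙ(a) ∪ {1}`. -/
def conjP1 {S : Type*} [MonoidWithZero S] (a : S) : Set S := conjP a ∪ {1}

/-- The conjugacy relation `a ∼_c b`. -/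
def ConjC {S : Type*} [MonoidWithZero S] (a b : S) : Prop :=
  ∃ g ∈ conjP1 a, ∃ h ∈ conjP1 b, a * g = g * b ∧ b * h = h * a

/-- `b` dominates `a`, for sequences of ordinals. -/
def Dominates (b a : ℕ → Ordinal) : Prop := ∃ k : ℕ, ∀ n : ℕ, a n ≤ b (k + n)

/-- The standard antichain of a set `M` of positive integers: the elements of `M` that are not
multiples of any smaller element of `M`. -/
def standardAntichain (M : Set ℕ) : Set ℕ := {m | m ∈ M ∧ ∀ l ∈ M, l < m → ¬ l ∣ m}

namespace PTrans

variable {X : Type*}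

/-- The arc relation `x → y` of the digraph of `α`: `x ∈ dom α` and `x α = y`. -/
def Arc (α : PTrans X) (x y : X) : Prop := α x = some y

def dom (α : PTrans X) : Set X := {x | ∃ y, α.Arc x y}

def im (α : PTrans X) : Set X := {y | ∃ x, α.Arc x y}

def span (α : PTrans X) : Set X := α.dom ∪ α.im

/-- `σ` is the cycle `(x 0, x 1, …, x (k - 1))` of length `k ≥ 1`. -/
def IsCycle (σ : PTrans X) (k : ℕ) (x : ℕ → X) : Prop :=
  1 ≤ k ∧ Set.InjOn x {i | i < k} ∧
    ∀ a b, σ.Arc a b ↔ ∃ i, i < k ∧ a = x i ∧ b = x ((i + 1) % k)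

/-- `σ` is the right ray `x 0 → x 1 → x 2 → …`. -/
def IsRightRay (σ : PTrans X) (x : ℕ → X) : Prop :=
  Function.Injective x ∧ ∀ a b, σ.Arc a b ↔ ∃ i, a = x i ∧ b = x (i + 1)

/-- `σ` is the double ray `… → x (-1) → x 0 → x 1 → …`. -/
def IsDoubleRay (σ : PTrans X) (x : ℤ → X) : Prop :=
  Function.Injective x ∧ ∀ a b, σ.Arc a b ↔ ∃ i, a = x i ∧ b = x (i + 1)

/-- `σ` is the left ray `… → x 2 → x 1 → x 0`. -/
def IsLeftRay (σ : PTrans X) (x : ℕ → X) : Prop :=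
  Function.Injective x ∧ ∀ a b, σ.Arc a b ↔ ∃ i, a = x (i + 1) ∧ b = x i

/-- `σ` is the chain `x 0 → x 1 → … → x k` of length `k ≥ 1`. -/
def IsChain (σ : PTrans X) (k : ℕ) (x : ℕ → X) : Prop :=
  1 ≤ k ∧ Set.InjOn x {i | i ≤ k} ∧
    ∀ a b, σ.Arc a b ↔ ∃ i, i < k ∧ a = x i ∧ b = x (i + 1)

/-- `β` is contained in `α`: `dom β ⊆ dom α` and `x β = x α` for all `x ∈ dom β`. -/
def ContainedIn (β α : PTrans X) : Prop := β.dom ⊆ α.dom ∧ ∀ x ∈ β.dom, β x = α x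

/-- The (basic) transformation `μ` is contained in `α` and maximal in `α`. -/
def MaximalIn (μ α : PTrans X) : Prop :=
  μ.ContainedIn α ∧ ∀ x ∈ μ.span, (x ∉ μ.dom → x ∉ α.dom) ∧ (x ∉ μ.im → x ∉ α.im)

def HasCycle (α : PTrans X) : Prop := ∃ σ k x, IsCycle σ k x ∧ σ.ContainedIn α

def HasRightRay (α : PTrans X) : Prop := ∃ σ x, IsRightRay σ x ∧ σ.ContainedIn α

def HasDoubleRay (α : PTrans X) : Prop := ∃ σ x, IsDoubleRay σ x ∧ σ.ContainedIn α

def HasLeftRay (α : PTrans X) : Prop := ∃ σ x, IsLeftRay σ x ∧ σ.ContainedIn α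

/-- The right ray `x 0 → x 1 → x 2 → …` is a maximal right ray in `α`. -/
def MaxRightRay (α : PTrans X) (x : ℕ → X) : Prop := ∃ σ, IsRightRay σ x ∧ σ.MaximalIn α

def HasMaxLeftRay (α : PTrans X) : Prop := ∃ σ x, IsLeftRay σ x ∧ σ.MaximalIn α

def HasMaxChain (α : PTrans X) : Prop := ∃ σ k x, IsChain σ k x ∧ σ.MaximalIn α

/-- `γ ≠ 0`, and any two points of the span have a common (defined) forward iterate. -/
def Connected (γ : PTrans X) : Prop :=
  γ ≠ 0 ∧ ∀ x ∈ γ.span, ∀ y ∈ γ.span,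
    ∃ k m : ℕ, (γ ^ k : PTrans X) x = (γ ^ m : PTrans X) y ∧ (γ ^ k : PTrans X) x ≠ none

/-- `α` is the join of `C`, for a set `C` of pairwise disjoint partial transformations. -/
def IsJoin (C : Set (PTrans X)) (α : PTrans X) : Prop :=
  ∀ x y, α.Arc x y ↔ ∃ γ ∈ C, γ.Arc x y

/-- `C` is a decomposition of `α`: a set of pairwise completely disjoint, connected partial
transformations contained in `α` whose join is `α`. -/
def IsDecomposition (C : Set (PTrans X)) (α : PTrans X) : Prop :=
  (∀ γ ∈ C, γ.Connected ∧ γ.ContainedIn α) ∧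
    (∀ γ ∈ C, ∀ δ ∈ C, γ ≠ δ → Disjoint γ.span δ.span) ∧ IsJoin C α

/-- `γ` is a connected component of `α`: a member of the (unique) decomposition of `α`. -/
def IsComponent (γ α : PTrans X) : Prop := ∃ C, IsDecomposition C α ∧ γ ∈ C

/-- Type *rro* ("right rays only"). -/
def TypeRro (γ : PTrans X) : Prop :=
  γ.Connected ∧ (∃ x, γ.MaxRightRay x) ∧
    ¬ γ.HasCycle ∧ ¬ γ.HasDoubleRay ∧ ¬ γ.HasLeftRay ∧ ¬ γ.HasMaxChain

/-- Type *cho* ("chains only"). -/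
def TypeCho (γ : PTrans X) : Prop :=
  γ.Connected ∧ γ.HasMaxChain ∧
    ¬ γ.HasCycle ∧ ¬ γ.HasRightRay ∧ ¬ γ.HasDoubleRay ∧ ¬ γ.HasLeftRay

/-- `x` is a terminal vertex in the span of `γ`. For `γ` connected there is at most one such vertex,
and it is called the root of `γ`. -/
def IsRoot (γ : PTrans X) (x : X) : Prop := x ∈ γ.span ∧ x ∉ γ.dom

/-- The arc relation is well founded if `γ` has no cycle and no left ray; in particular this holds for
`γ` of type *rro* or *cho*. -/
theorem wellFounded_arc (γ : PTrans X) (hc : ¬ γ.HasCycle) (hl : ¬ γ.HasLeftRay) :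
    WellFounded γ.Arc := by
  classical
  rw [wellFounded_iff_isEmpty_descending_chain]
  refine ⟨fun ⟨f, hf⟩ => ?_⟩
  have restr : ∀ S : Set X, ∃ σ : PTrans X, σ.ContainedIn γ ∧
      ∀ a b, σ.Arc a b ↔ a ∈ S ∧ γ.Arc a b := by
    intro S
    have key : ∀ a b, Arc (fun a => if a ∈ S then γ a else none) a b ↔ a ∈ S ∧ γ.Arc a b := by
      intro a b
      by_cases h : a ∈ S <;> simp [Arc, h]
    refine ⟨fun a => if a ∈ S then γ a else none, ⟨?_, ?_⟩, key⟩
    · rintro a ⟨b, hab⟩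
      exact ⟨b, ((key a b).1 hab).2⟩
    · rintro a ⟨b, hab⟩
      exact hab.trans ((key a b).1 hab).2.symm
  by_cases hinj : Function.Injective f
  · obtain ⟨σ, hσ, h⟩ := restr {a | ∃ i, a = f (i + 1)}
    refine hl ⟨σ, f, ⟨hinj, fun a b => (h a b).trans ⟨?_, ?_⟩⟩, hσ⟩
    · rintro ⟨⟨i, rfl⟩, hab⟩
      exact ⟨i, rfl, (Option.some.inj ((hf i).symm.trans hab)).symm⟩
    · rintro ⟨i, rfl, rfl⟩
      exact ⟨⟨i, rfl⟩, hf i⟩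
  · have hex : ∃ d, 1 ≤ d ∧ ∃ i, f i = f (i + d) := by
      simp only [Function.Injective, not_forall] at hinj
      obtain ⟨i, j, hij, hne⟩ := hinj
      rcases Nat.lt_or_gt_of_ne hne with h | h
      · exact ⟨j - i, by omega, i, by rw [hij]; congr 1; omega⟩
      · exact ⟨i - j, by omega, j, by rw [← hij]; congr 1; omega⟩
    obtain ⟨hd, i, hi⟩ := Nat.find_spec hex
    have hmin : ∀ e, 1 ≤ e → e < Nat.find hex → ∀ j, f j ≠ f (j + e) :=
      fun e he hlt j hj => Nat.find_min hex hlt ⟨he, j, hj⟩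
    generalize Nat.find hex = d at hd hi hmin
    have harc : ∀ t, t < d → γ.Arc (f (i + d - t)) (f (i + d - (t + 1) % d)) := by
      intro t ht
      have h1 : γ.Arc (f (i + d - t)) (f (i + d - (t + 1))) := by
        have h2 := hf (i + d - (t + 1))
        rwa [show i + d - (t + 1) + 1 = i + d - t by omega] at h2
      rcases Nat.lt_or_ge (t + 1) d with h | h
      · rwa [Nat.mod_eq_of_lt h]
      · obtain rfl : d = t + 1 := by omega
        rw [Nat.mod_self, Nat.sub_zero, ← hi]
        rwa [Nat.add_sub_cancel] at h1
    obtain ⟨σ, hσ, h⟩ := restr {a | ∃ t, t < d ∧ a = f (i + d - t)}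
    refine hc ⟨σ, d, fun t => f (i + d - t), ⟨hd, ?_, fun a b => (h a b).trans ⟨?_, ?_⟩⟩, hσ⟩
    · intro s hs t ht hst
      change s < d at hs
      change t < d at ht
      change f (i + d - s) = f (i + d - t) at hst
      by_contra hne
      rcases Nat.lt_or_gt_of_ne hne with h | h
      · refine hmin (t - s) (by omega) (by omega) (i + d - t) (hst.symm.trans ?_)
        congr 1; omega
      · refine hmin (s - t) (by omega) (by omega) (i + d - s) (hst.trans ?_)
        congr 1; omega
    · rintro ⟨⟨t, ht, rfl⟩, hab⟩
      exact ⟨t, ht, rfl, (Option.some.inj ((harc t ht).symm.trans hab)).symm⟩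
    · rintro ⟨t, ht, rfl, rfl⟩
      exact ⟨⟨t, ht, rfl⟩, harc t ht⟩

open Classical in
/-- The rank `ρ_γ(x) = sup {ρ_γ(y) + 1 : y → x}` of `x` for the relation `y → x`. It is used only for
`γ` of type *rro* or *cho*, where this relation is well founded (see `wellFounded_arc`), so that
the value `0` of the second case is never taken. -/
noncomputable def rank {X : Type*} (γ : PTrans X) (x : X) : Ordinal :=
  if h : Acc γ.Arc x then h.rank else 0

/-- The set of lengths of the cycles of `α`. -/
def cycleLengths (α : PTrans X) : Set ℕ :=
  {n | 1 ≤ n ∧ ∃ x ∈ α.dom, (α ^ n : PTrans X) x = some x ∧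
    ∀ i, 1 ≤ i → i < n → (α ^ i : PTrans X) x ≠ some x}

/-- The cycle set `cs(α)` (empty if `α` has no cycle). -/
def cycleSet (α : PTrans X) : Set ℕ := standardAntichain α.cycleLengths

end PTrans

/-! For nonzero `α` and `β` the relation splits into two independent one-sided problems. The
condition `g ∈ conjP1 α` says that `g` is defined on the image of `α`, and `α * g = g * β` then
forces it to be defined on the domain too. So such a `g` amounts to a map of points that sends arcs
to arcs and terminal vertices to terminal ones (`exists_isRpHom_iff`), and `∼_c` becomes the
existence of homomorphisms `IsRpHom` in both directions.

Necessity: a homomorphism sends a cycle to a cycle whose length divides the original one, a double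
ray to a double ray unless the target has a cycle, a left ray ending in a terminal vertex to another
such ray, and it never lowers ranks (`rank_le_rank`). Components of type rro and cho are recognised
by the absence of obstructions (`typeRro_of`, `typeCho_of`).

Sufficiency: homomorphisms are built separately on each class of points with common iterates
(`exists_isRpHom_of_local`). A class is the forward orbit of a base point with backward trees
attached, so it suffices to map the orbit and to lift predecessors step by step
(`exists_isLocalHom`). A class with a terminal vertex goes to a maximal left ray, or else to a cho
component of sufficient rank. Any other class goes to a cycle, a double ray, or an rro component
whose ranks dominate. On cycles and on left or double rays predecessors always exist. In the other
targets the inequality of ranks supplies them (`exists_arc_of_rank_le`). -/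

namespace PTrans

variable {X : Type*} {α β γ δ : PTrans X}

/-! ### Iterates -/

theorem iter_zero (α : PTrans X) (x : X) : (α ^ 0 : PTrans X) x = some x := by
  rw [pow_zero]; rfl

theorem iter_add (α : PTrans X) (m n : ℕ) (x : X) :
    (α ^ (m + n) : PTrans X) x = ((α ^ m : PTrans X) x).bind (α ^ n : PTrans X) := by
  rw [pow_add]; rfl

theorem iter_one (α : PTrans X) (x : X) : (α ^ 1 : PTrans X) x = α x := by
  rw [pow_one]

theorem iter_add_of {m : ℕ} {x y : X} (h : (α ^ m : PTrans X) x = some y) (n : ℕ) :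
    (α ^ (m + n) : PTrans X) x = (α ^ n : PTrans X) y := by
  rw [iter_add, h]; rfl

theorem iter_succ_of {x y : X} (h : α x = some y) (n : ℕ) :
    (α ^ (n + 1) : PTrans X) x = (α ^ n : PTrans X) y := by
  rw [Nat.add_comm]; exact iter_add_of ((iter_one α x).trans h) n

theorem iter_succ_last {m : ℕ} {x y : X} (h : (α ^ m : PTrans X) x = some y) :
    (α ^ (m + 1) : PTrans X) x = α y := by
  rw [iter_add_of h, iter_one]

theorem iter_succ_none {x : X} (h : α x = none) (n : ℕ) :
    (α ^ (n + 1) : PTrans X) x = none := by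
  rw [Nat.add_comm, iter_add, iter_one, h]; rfl

theorem iter_none_of_lt {m n : ℕ} {x z : X} (h : (α ^ m : PTrans X) x = some z)
    (hz : α z = none) (hmn : m < n) : (α ^ n : PTrans X) x = none := by
  obtain ⟨d, rfl⟩ := Nat.exists_eq_add_of_lt hmn
  rw [Nat.add_assoc, iter_add_of h, iter_succ_none hz]

theorem iter_of_iter_succ {n : ℕ} {x z : X} (h : (α ^ (n + 1) : PTrans X) x = some z) :
    ∃ y, α x = some y ∧ (α ^ n : PTrans X) y = some z := by
  cases hx : α x with
  | none => rw [iter_succ_none hx] at h; exact absurd h (by simp)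
  | some y => exact ⟨y, rfl, by rw [← iter_succ_of hx, h]⟩

theorem iter_defined_of_le {m n : ℕ} {x z : X} (h : (α ^ n : PTrans X) x = some z)
    (hmn : m ≤ n) : ∃ y, (α ^ m : PTrans X) x = some y := by
  obtain ⟨d, rfl⟩ := Nat.exists_eq_add_of_le hmn
  rw [iter_add] at h
  cases hx : (α ^ m : PTrans X) x with
  | none => rw [hx] at h; exact absurd h (Option.some_ne_none z).symm
  | some y => exact ⟨y, rfl⟩

theorem iter_walk {w : ℕ → X} (hw : ∀ i, α.Arc (w i) (w (i + 1))) (i n : ℕ) :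
    (α ^ n : PTrans X) (w i) = some (w (i + n)) := by
  induction n with
  | zero => exact iter_zero α _
  | succ n ih => rw [iter_succ_last ih]; exact hw _

theorem iter_left_walk {w : ℕ → X} (hw : ∀ i, α.Arc (w (i + 1)) (w i)) (i n : ℕ) :
    (α ^ n : PTrans X) (w (i + n)) = some (w i) := by
  induction n with
  | zero => exact iter_zero α _
  | succ n ih => exact (iter_succ_of (hw (i + n)) n).trans ih

theorem mem_dom_iff {x : X} : x ∈ α.dom ↔ α x ≠ none :=
  (Option.ne_none_iff_exists').symm

theorem not_mem_dom_iff {x : X} : x ∉ α.dom ↔ α x = none := by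
  rw [mem_dom_iff, not_not]

theorem Arc.left_mem {x y : X} (h : α.Arc x y) : x ∈ α.span := Or.inl ⟨y, h⟩

theorem Arc.right_mem {x y : X} (h : α.Arc x y) : y ∈ α.span := Or.inr ⟨x, h⟩

theorem ContainedIn.arc (h : γ.ContainedIn α) {x y : X} (hxy : γ.Arc x y) : α.Arc x y :=
  (h.2 x ⟨y, hxy⟩).symm.trans hxy

theorem containedIn_of_arc (h : ∀ x y, γ.Arc x y → α.Arc x y) : γ.ContainedIn α :=
  ⟨fun x ⟨y, hy⟩ => ⟨y, h x y hy⟩, fun x ⟨y, hy⟩ => hy.trans (h x y hy).symm⟩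

theorem ContainedIn.trans (h : γ.ContainedIn δ) (h' : δ.ContainedIn α) : γ.ContainedIn α :=
  containedIn_of_arc fun _ _ hxy => h'.arc (h.arc hxy)

theorem iter_mem_span {n : ℕ} {x y : X} (hx : x ∈ α.span)
    (h : (α ^ n : PTrans X) x = some y) : y ∈ α.span := by
  induction n generalizing x with
  | zero => rw [iter_zero] at h; exact Option.some.inj h ▸ hx
  | succ n ih =>
    obtain ⟨z, hz, h⟩ := iter_of_iter_succ h
    exact ih (Arc.right_mem hz) h

/-- The restriction of a partial transformation to a set. -/
theorem exists_restriction (α : PTrans X) (S : Set X) :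
    ∃ σ : PTrans X, σ.ContainedIn α ∧ ∀ a b, σ.Arc a b ↔ a ∈ S ∧ α.Arc a b := by
  classical
  have key : ∀ a b, Arc (fun a => if a ∈ S then α a else none) a b ↔ a ∈ S ∧ α.Arc a b := by
    intro a b
    by_cases h : a ∈ S <;> simp [Arc, h]
  exact ⟨_, containedIn_of_arc fun a b hab => ((key a b).1 hab).2, key⟩

/-! ### Points with a common forward iterate -/

/-- `x` and `y` have a common forward iterate. -/
def Joined (α : PTrans X) (x y : X) : Prop :=
  ∃ k m z, (α ^ k : PTrans X) x = some z ∧ (α ^ m : PTrans X) y = some z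

theorem Joined.refl (α : PTrans X) (x : X) : α.Joined x x :=
  ⟨0, 0, x, iter_zero α x, iter_zero α x⟩

theorem Joined.symm {x y : X} (h : α.Joined x y) : α.Joined y x := by
  obtain ⟨k, m, z, h, h'⟩ := h
  exact ⟨m, k, z, h', h⟩

/-- The two iterates of `y` lie on one orbit, so the earlier one can be moved forward to the later.
-/
theorem Joined.trans {x y u : X} (h : α.Joined x y) (h' : α.Joined y u) : α.Joined x u := by
  obtain ⟨k, m, z, hx, hy⟩ := h
  obtain ⟨l, n, w, hy', hu⟩ := h'
  rcases Nat.le_total m l with hml | hml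
  · obtain ⟨d, rfl⟩ := Nat.exists_eq_add_of_le hml
    exact ⟨k + d, n, w, by rw [iter_add_of hx, ← hy', iter_add_of hy], hu⟩
  · obtain ⟨d, rfl⟩ := Nat.exists_eq_add_of_le hml
    exact ⟨k, n + d, z, hx, by rw [iter_add_of hu, ← hy, iter_add_of hy']⟩

theorem joined_of_iter {x y : X} {n : ℕ} (h : (α ^ n : PTrans X) x = some y) : α.Joined x y :=
  ⟨n, 0, y, h, iter_zero α y⟩

theorem Arc.joined {x y : X} (h : α.Arc x y) : α.Joined x y :=
  joined_of_iter (n := 1) ((iter_one α x).trans h)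

theorem Joined.mem_span {x y : X} (h : α.Joined x y) (hx : x ∈ α.span) : y ∈ α.span := by
  obtain ⟨k, m, z, hk, hm⟩ := h
  have hz := iter_mem_span hx hk
  cases m with
  | zero => rw [iter_zero] at hm; exact Option.some.inj hm ▸ hz
  | succ m => obtain ⟨w, hw, _⟩ := iter_of_iter_succ hm; exact Arc.left_mem hw

/-- In the class of a terminal vertex `z` every point has `z` as an iterate. -/
theorem Joined.iter_terminal {x z : X} (h : α.Joined x z) (hz : α z = none) :
    ∃ k, (α ^ k : PTrans X) x = some z := by
  obtain ⟨k, m, w, hk, hm⟩ := h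
  cases m with
  | zero => rw [iter_zero] at hm; exact ⟨k, by rw [hk, hm]⟩
  | succ m => rw [iter_succ_none hz] at hm; exact absurd hm (by simp)

/-! ### Connected components -/

/-- The components are the restrictions `c s` of `α` to the classes of `Joined`. Iterates never
leave a class, so a common iterate under `α` is also one under the restriction. -/
theorem exists_isComponent {r : X} (hr : r ∈ α.span) : ∃ γ : PTrans X, γ.IsComponent α ∧ r ∈ γ.span := by
  choose c hc hca using fun s => exists_restriction α {x | α.Joined s x}
  have hspan : ∀ s x, x ∈ (c s).span → α.Joined s x := by
    rintro s x (⟨y, h⟩ | ⟨y, h⟩)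
    · exact ((hca s _ _).1 h).1
    · exact (((hca s _ _).1 h).1).trans ((hca s _ _).1 h).2.joined
  have hmem : ∀ s ∈ α.span, s ∈ (c s).span := by
    rintro s (⟨y, h⟩ | ⟨y, h⟩)
    · exact Or.inl ⟨y, (hca s _ _).2 ⟨Joined.refl α s, h⟩⟩
    · exact Or.inr ⟨y, (hca s _ _).2 ⟨(Arc.joined h).symm, h⟩⟩
  have hiter : ∀ s k x z, α.Joined s x → (α ^ k : PTrans X) x = some z →
      (c s ^ k : PTrans X) x = some z := by
    intro s k
    induction k with
    | zero => intro x z _ h; rw [iter_zero] at h ⊢; exact h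
    | succ k ih =>
      intro x z hx h
      obtain ⟨y, hxy, h⟩ := iter_of_iter_succ h
      rw [iter_succ_of ((hca s x y).2 ⟨hx, hxy⟩)]
      exact ih y z (hx.trans (Arc.joined hxy)) h
  refine ⟨c r, ⟨c '' α.span, ⟨?_, ?_, ?_⟩, ⟨r, hr, rfl⟩⟩, hmem r hr⟩
  · rintro _ ⟨s, hs, rfl⟩
    refine ⟨⟨fun h0 => ?_, fun x hx y hy => ?_⟩, hc s⟩
    · have := hmem s hs
      rw [h0] at this
      rcases this with ⟨y, h⟩ | ⟨y, h⟩ <;> exact absurd h (Option.some_ne_none _).symm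
    · have hx := hspan s x hx
      have hy := hspan s y hy
      obtain ⟨k, m, z, hk, hm⟩ := hx.symm.trans hy
      refine ⟨k, m, ?_, ?_⟩
      · rw [hiter s k x z hx hk, hiter s m y z hy hm]
      · rw [hiter s k x z hx hk]; simp
  · rintro _ ⟨s, -, rfl⟩ _ ⟨t, -, rfl⟩ hne
    rw [Set.disjoint_left]
    intro x hx hx'
    have hst : α.Joined s t := (hspan s x hx).trans (hspan t x hx').symm
    refine hne (funext fun a => Option.ext fun b => ?_)
    refine (hca s a b).trans (Iff.trans ?_ (hca t a b).symm)
    exact and_congr_left fun _ => ⟨fun h => hst.symm.trans h, fun h => hst.trans h⟩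
  · refine fun x y => ⟨fun h => ⟨c x, ⟨x, h.left_mem, rfl⟩, (hca x x y).2 ⟨Joined.refl α x, h⟩⟩, ?_⟩
    rintro ⟨_, ⟨s, -, rfl⟩, h⟩
    exact ((hca s x y).1 h).2

theorem IsComponent.connected (h : γ.IsComponent α) : γ.Connected := by
  obtain ⟨C, hC, hγ⟩ := h
  exact (hC.1 γ hγ).1

theorem IsComponent.containedIn (h : γ.IsComponent α) : γ.ContainedIn α := by
  obtain ⟨C, hC, hγ⟩ := h
  exact (hC.1 γ hγ).2

/-- Every arc of `α` lies in some member of the decomposition, and disjointness of spans forces that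
member to be `γ`. -/
theorem IsComponent.arc_of_left (h : γ.IsComponent α) {x y : X} (hx : x ∈ γ.span)
    (hxy : α.Arc x y) : γ.Arc x y := by
  obtain ⟨C, ⟨-, h2, h3⟩, hγ⟩ := h
  obtain ⟨δ, hδ, hd⟩ := (h3 x y).1 hxy
  by_cases hne : γ = δ
  · rwa [hne]
  · exact absurd hd.left_mem (Set.disjoint_left.1 (h2 γ hγ δ hδ hne) hx)

theorem IsComponent.arc_of_right (h : γ.IsComponent α) {x y : X} (hy : y ∈ γ.span)
    (hxy : α.Arc x y) : γ.Arc x y := by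
  obtain ⟨C, ⟨-, h2, h3⟩, hγ⟩ := h
  obtain ⟨δ, hδ, hd⟩ := (h3 x y).1 hxy
  by_cases hne : γ = δ
  · rwa [hne]
  · exact absurd hd.right_mem (Set.disjoint_left.1 (h2 γ hγ δ hδ hne) hy)

theorem IsComponent.apply_eq (h : γ.IsComponent α) {x : X} (hx : x ∈ γ.span) : γ x = α x :=
  Option.ext fun _ => ⟨fun hy => h.containedIn.arc hy, fun hy => h.arc_of_left hx hy⟩

theorem IsComponent.span_subset (h : γ.IsComponent α) {x : X} (hx : x ∈ γ.span) : x ∈ α.span := by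
  rcases hx with ⟨y, hy⟩ | ⟨y, hy⟩
  · exact Arc.left_mem (h.containedIn.arc hy)
  · exact Arc.right_mem (h.containedIn.arc hy)

theorem ContainedIn.iter (h : γ.ContainedIn α) {n : ℕ} {x z : X}
    (hx : (γ ^ n : PTrans X) x = some z) : (α ^ n : PTrans X) x = some z := by
  induction n generalizing x with
  | zero => rw [iter_zero] at hx ⊢; exact hx
  | succ n ih =>
    obtain ⟨y, hxy, hy⟩ := iter_of_iter_succ hx
    rw [iter_succ_of (h.arc hxy), ih hy]

theorem ContainedIn.joined (h : γ.ContainedIn α) {x y : X} (hxy : γ.Joined x y) :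
    α.Joined x y := by
  obtain ⟨k, m, z, hk, hm⟩ := hxy
  exact ⟨k, m, z, h.iter hk, h.iter hm⟩

theorem Connected.joined (h : γ.Connected) {x y : X} (hx : x ∈ γ.span) (hy : y ∈ γ.span) :
    γ.Joined x y := by
  obtain ⟨k, m, he, hne⟩ := h.2 x hx y hy
  obtain ⟨z, hz⟩ := Option.ne_none_iff_exists'.1 hne
  exact ⟨k, m, z, hz, by rw [← he, hz]⟩

/-! ### Cycles -/

theorem iter_mul_of_period {x : X} {n : ℕ} (h : (α ^ n : PTrans X) x = some x) (q r : ℕ) :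
    (α ^ (n * q + r) : PTrans X) x = (α ^ r : PTrans X) x := by
  induction q with
  | zero => simp
  | succ q ih => rw [Nat.mul_succ, Nat.add_comm (n * q) n, Nat.add_assoc, iter_add_of h, ih]

theorem iter_mod_of_period {x : X} {n : ℕ} (h : (α ^ n : PTrans X) x = some x) (i : ℕ) :
    (α ^ i : PTrans X) x = (α ^ (i % n) : PTrans X) x := by
  conv_lhs => rw [← Nat.div_add_mod i n]
  exact iter_mul_of_period h _ _

/-- `n` is the least positive period of `x`. -/
def MinPeriod (α : PTrans X) (n : ℕ) (x : X) : Prop :=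
  1 ≤ n ∧ (α ^ n : PTrans X) x = some x ∧
    ∀ i, 1 ≤ i → i < n → (α ^ i : PTrans X) x ≠ some x

theorem exists_minPeriod {x : X} {n : ℕ} (hn : 1 ≤ n) (h : (α ^ n : PTrans X) x = some x) :
    ∃ m, α.MinPeriod m x := by
  classical
  have hex : ∃ m, 1 ≤ m ∧ (α ^ m : PTrans X) x = some x := ⟨n, hn, h⟩
  exact ⟨Nat.find hex, (Nat.find_spec hex).1, (Nat.find_spec hex).2,
    fun i hi hlt he => Nat.find_min hex hlt ⟨hi, he⟩⟩

theorem MinPeriod.defined {x : X} {n : ℕ} (h : α.MinPeriod n x) (i : ℕ) :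
    ∃ y, (α ^ i : PTrans X) x = some y := by
  rw [iter_mod_of_period h.2.1]
  exact iter_defined_of_le h.2.1 (Nat.mod_lt _ h.1).le

theorem MinPeriod.mod_eq {x : X} {n : ℕ} (h : α.MinPeriod n x) {i j : ℕ}
    (hij : (α ^ i : PTrans X) x = (α ^ j : PTrans X) x) : i % n = j % n := by
  have key : ∀ a b, a < b → b < n → (α ^ a : PTrans X) x ≠ (α ^ b : PTrans X) x := by
    intro a b hab hb he
    obtain ⟨y, hy⟩ := h.defined a
    -- Running both orbits `n - b` steps further brings the second back to `x`, so `a + (n - b) < n`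
    -- would be a period.
    have h1 : (α ^ (b + (n - b)) : PTrans X) x = (α ^ (a + (n - b)) : PTrans X) x := by
      rw [iter_add_of hy, iter_add_of (he ▸ hy)]
    rw [show b + (n - b) = n by omega, h.2.1] at h1
    exact h.2.2 _ (by omega) (by omega) h1.symm
  rw [iter_mod_of_period h.2.1 i, iter_mod_of_period h.2.1 j] at hij
  rcases Nat.lt_trichotomy (i % n) (j % n) with hlt | he | hlt
  · exact absurd hij (key _ _ hlt (Nat.mod_lt _ h.1))
  · exact he
  · exact absurd hij.symm (key _ _ hlt (Nat.mod_lt _ h.1))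

theorem mem_cycleLengths_iff {n : ℕ} : n ∈ α.cycleLengths ↔ ∃ x, α.MinPeriod n x := by
  constructor
  · rintro ⟨hn, x, -, h⟩
    exact ⟨x, hn, h⟩
  · rintro ⟨x, h⟩
    obtain ⟨y, hy⟩ := iter_defined_of_le h.2.1 h.1
    rw [iter_one] at hy
    exact ⟨h.1, x, ⟨y, hy⟩, h.2⟩

theorem hasCycle_of_minPeriod {x : X} {n : ℕ} (h : α.MinPeriod n x) : α.HasCycle := by
  choose c hc using h.defined
  obtain ⟨σ, hσ, hσa⟩ := exists_restriction α {a | ∃ i, i < n ∧ a = c i}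
  have harc : ∀ i, α.Arc (c i) (c ((i + 1) % n)) := by
    intro i
    have h1 := hc ((i + 1) % n)
    rw [← iter_mod_of_period h.2.1, iter_succ_last (hc i)] at h1
    exact h1
  refine ⟨σ, n, c, ⟨h.1, ?_, fun a b => (hσa a b).trans ⟨?_, ?_⟩⟩, hσ⟩
  · intro i hi j hj hij
    have := h.mod_eq (i := i) (j := j) (by rw [hc, hc, hij])
    rwa [Nat.mod_eq_of_lt hi, Nat.mod_eq_of_lt hj] at this
  · rintro ⟨⟨i, hi, rfl⟩, hab⟩
    exact ⟨i, hi, rfl, Option.some.inj (hab.symm.trans (harc i))⟩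
  · rintro ⟨i, hi, rfl, rfl⟩
    exact ⟨⟨i, hi, rfl⟩, harc i⟩

theorem hasCycle_iff : α.HasCycle ↔ ∃ x n, 1 ≤ n ∧ (α ^ n : PTrans X) x = some x := by
  constructor
  · rintro ⟨σ, k, x, ⟨hk, -, harc⟩, hσ⟩
    have h : ∀ i, (α ^ i : PTrans X) (x 0) = some (x (i % k)) := by
      intro i
      induction i with
      | zero => rw [iter_zero, Nat.zero_mod]
      | succ i ih =>
        rw [iter_succ_last ih]
        have := hσ.arc ((harc _ _).2 ⟨i % k, Nat.mod_lt _ hk, rfl, rfl⟩)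
        rwa [Nat.mod_add_mod] at this
    exact ⟨x 0, k, hk, by rw [h, Nat.mod_self]⟩
  · rintro ⟨x, n, hn, h⟩
    obtain ⟨m, hm⟩ := exists_minPeriod hn h
    exact hasCycle_of_minPeriod hm

theorem hasCycle_iff_nonempty : α.HasCycle ↔ α.cycleLengths.Nonempty := by
  constructor
  · intro h
    obtain ⟨x, n, hn, h⟩ := hasCycle_iff.1 h
    obtain ⟨m, hm⟩ := exists_minPeriod hn h
    exact ⟨m, mem_cycleLengths_iff.2 ⟨x, hm⟩⟩
  · rintro ⟨n, hn⟩
    obtain ⟨x, hx⟩ := mem_cycleLengths_iff.1 hn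
    exact hasCycle_of_minPeriod hx

theorem HasCycle.mono (h : γ.ContainedIn α) (hc : γ.HasCycle) : α.HasCycle := by
  obtain ⟨σ, k, x, hx, hσ⟩ := hc
  exact ⟨σ, k, x, hx, hσ.trans h⟩

theorem HasDoubleRay.mono (h : γ.ContainedIn α) (hc : γ.HasDoubleRay) : α.HasDoubleRay := by
  obtain ⟨σ, x, hx, hσ⟩ := hc
  exact ⟨σ, x, hx, hσ.trans h⟩

/-! ### Standard antichains -/

theorem exists_mem_standardAntichain {M : Set ℕ} {n : ℕ} (hn : n ∈ M) :
    ∃ m ∈ standardAntichain M, m ∣ n := by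
  induction n using Nat.strong_induction_on with
  | _ n ih =>
    by_cases h : ∃ l ∈ M, l < n ∧ l ∣ n
    · obtain ⟨l, hl, hlt, hd⟩ := h
      obtain ⟨m, hm, hml⟩ := ih l hlt hl
      exact ⟨m, hm, hml.trans hd⟩
    · push Not at h
      exact ⟨n, ⟨hn, h⟩, dvd_rfl⟩

/-- An element `m` minimal in `M` has a divisor `l` in `N`, which has a divisor `k` in `M`;
minimality gives `k = m`, hence `l = m`. -/
theorem standardAntichain_subset {M N : Set ℕ} (hM : ∀ n ∈ M, 1 ≤ n)
    (hMN : ∀ n ∈ M, ∃ m ∈ N, m ∣ n) (hNM : ∀ n ∈ N, ∃ m ∈ M, m ∣ n) :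
    standardAntichain M ⊆ standardAntichain N := by
  rintro m ⟨hm, hmin⟩
  have key : ∀ l ∈ N, l ∣ m → l = m := by
    intro l hl hlm
    obtain ⟨k, hk, hkl⟩ := hNM l hl
    have hle := Nat.le_of_dvd (hM m hm) (hkl.trans hlm)
    have hkm : k = m := hle.eq_of_not_lt fun hlt => hmin k hk hlt (hkl.trans hlm)
    exact Nat.dvd_antisymm hlm (hkm ▸ hkl)
  obtain ⟨l, hl, hlm⟩ := hMN m hm
  exact ⟨key l hl hlm ▸ hl, fun l hl hlt hd => hlt.ne (key l hl hd)⟩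

/-! ### Rays and chains as walks -/

/-- A repetition in the walk would close up to a cycle, so injectivity is automatic. -/
theorem hasDoubleRay_of_walk (hc : ¬ α.HasCycle) {w : ℤ → X} (hw : ∀ i, α.Arc (w i) (w (i + 1))) :
    α.HasDoubleRay := by
  have hit : ∀ (n : ℕ) (i : ℤ), (α ^ n : PTrans X) (w i) = some (w (i + n)) := by
    intro n
    induction n with
    | zero => intro i; rw [iter_zero]; simp
    | succ n ih =>
      intro i
      rw [iter_succ_of (hw i), ih, show i + 1 + (n : ℤ) = i + ((n + 1 : ℕ) : ℤ) by push_cast; ring]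
  have hne : ∀ i j, i < j → w i ≠ w j := by
    intro i j hij he
    refine hc (hasCycle_iff.2 ⟨w i, (j - i).toNat, by omega, ?_⟩)
    rw [hit, Int.toNat_of_nonneg (by omega), add_sub_cancel, ← he]
  obtain ⟨σ, hσ, hσa⟩ := exists_restriction α (Set.range w)
  refine ⟨σ, w, ⟨?_, fun a b => (hσa a b).trans ⟨?_, ?_⟩⟩, hσ⟩
  · intro i j hij
    by_contra hn
    rcases lt_or_gt_of_ne hn with h | h
    · exact hne i j h hij
    · exact hne j i h hij.symm
  · rintro ⟨⟨i, rfl⟩, hab⟩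
    exact ⟨i, rfl, Option.some.inj (hab.symm.trans (hw i))⟩
  · rintro ⟨i, rfl, rfl⟩
    exact ⟨⟨i, rfl⟩, hw i⟩

theorem HasDoubleRay.exists_walk (h : α.HasDoubleRay) :
    ∃ w : ℤ → X, ∀ i, α.Arc (w i) (w (i + 1)) := by
  obtain ⟨σ, w, ⟨-, hw⟩, hσ⟩ := h
  exact ⟨w, fun i => hσ.arc ((hw _ _).2 ⟨i, rfl, rfl⟩)⟩

theorem HasLeftRay.exists_walk (h : α.HasLeftRay) :
    ∃ w : ℕ → X, ∀ i, α.Arc (w (i + 1)) (w i) := by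
  obtain ⟨σ, w, ⟨-, hw⟩, hσ⟩ := h
  exact ⟨w, fun i => hσ.arc ((hw _ _).2 ⟨i, rfl, rfl⟩)⟩

theorem HasRightRay.exists_walk (h : α.HasRightRay) :
    ∃ w : ℕ → X, ∀ i, α.Arc (w i) (w (i + 1)) := by
  obtain ⟨σ, w, ⟨-, hw⟩, hσ⟩ := h
  exact ⟨w, fun i => hσ.arc ((hw _ _).2 ⟨i, rfl, rfl⟩)⟩

/-- The number of steps to the terminal vertex `w 0` tells the points apart, so injectivity is free.
Maximality only concerns `w 0`, because every point of the ray has a predecessor on it. -/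
theorem hasMaxLeftRay_iff :
    α.HasMaxLeftRay ↔ ∃ w : ℕ → X, (∀ i, α.Arc (w (i + 1)) (w i)) ∧ α (w 0) = none := by
  constructor
  · rintro ⟨σ, w, ⟨hinj, hw⟩, hσ, hmax⟩
    have hσw : ∀ i, σ.Arc (w (i + 1)) (w i) := fun i => (hw _ _).2 ⟨i, rfl, rfl⟩
    refine ⟨w, fun i => hσ.arc (hσw i), ?_⟩
    rw [← not_mem_dom_iff]
    refine (hmax (w 0) (hσw 0).right_mem).1 ?_
    rintro ⟨b, hb⟩
    obtain ⟨i, hi, -⟩ := (hw _ _).1 hb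
    exact absurd (hinj hi) (by omega)
  · rintro ⟨w, hw, h0⟩
    obtain ⟨σ, hσ, hσa⟩ := exists_restriction α (Set.range fun i => w (i + 1))
    have hσw : ∀ i, σ.Arc (w (i + 1)) (w i) := fun i => (hσa _ _).2 ⟨⟨i, rfl⟩, hw i⟩
    have hit : ∀ i, (α ^ i : PTrans X) (w i) = some (w 0) := fun i => by
      simpa using iter_left_walk hw 0 i
    have hne : ∀ i j, i < j → w i ≠ w j := by
      intro i j hij he
      have h1 := iter_none_of_lt (hit i) h0 hij
      rw [he, hit j] at h1
      exact absurd h1 (by simp)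
    have harc : ∀ a b, σ.Arc a b ↔ ∃ i, a = w (i + 1) ∧ b = w i := by
      intro a b
      refine (hσa a b).trans ⟨?_, ?_⟩
      · rintro ⟨⟨i, rfl⟩, hab⟩
        exact ⟨i, rfl, Option.some.inj (hab.symm.trans (hw i))⟩
      · rintro ⟨i, rfl, rfl⟩
        exact ⟨⟨i, rfl⟩, hw i⟩
    refine ⟨σ, w, ⟨?_, harc⟩, hσ, fun x hx => ?_⟩
    · intro i j hij
      by_contra hn
      rcases lt_or_gt_of_ne hn with h | h
      · exact hne i j h hij
      · exact hne j i h hij.symm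
    · have hx' : ∃ i, x = w i := by
        rcases hx with ⟨b, hb⟩ | ⟨b, hb⟩
        · obtain ⟨i, hi, -⟩ := (harc _ _).1 hb
          exact ⟨_, hi⟩
        · obtain ⟨i, -, hi⟩ := (harc _ _).1 hb
          exact ⟨_, hi⟩
      obtain ⟨i, rfl⟩ := hx'
      refine ⟨fun hd => ?_, fun hi => absurd ⟨_, hσw i⟩ hi⟩
      cases i with
      | zero => rw [not_mem_dom_iff]; exact h0
      | succ i => exact absurd ⟨_, hσw i⟩ hd

theorem hasMaxLeftRay_of_reach {w : ℕ → X} (hw : ∀ i, α.Arc (w (i + 1)) (w i)) {k : ℕ} {z : X}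
    (hk : (α ^ k : PTrans X) (w 0) = some z) (hz : α z = none) : α.HasMaxLeftRay := by
  induction k generalizing w with
  | zero =>
    rw [iter_zero] at hk
    exact hasMaxLeftRay_iff.2 ⟨w, hw, by rw [Option.some.inj hk, hz]⟩
  | succ k ih =>
    obtain ⟨y, hy, hk⟩ := iter_of_iter_succ hk
    -- Prepending `y`, the successor of `w 0`, brings the end of the left walk one step closer to
    -- `z`.
    refine ih (w := fun i => Nat.casesOn i y w) (fun i => ?_) hk
    cases i with
    | zero => exact hy
    | succ i => exact hw i

theorem maxRightRay_of_walk (hc : ¬ α.HasCycle) {w : ℕ → X} (hw : ∀ i, α.Arc (w i) (w (i + 1)))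
    (h0 : w 0 ∉ α.im) : α.MaxRightRay w := by
  obtain ⟨σ, hσ, hσa⟩ := exists_restriction α (Set.range w)
  have hσw : ∀ i, σ.Arc (w i) (w (i + 1)) := fun i => (hσa _ _).2 ⟨⟨i, rfl⟩, hw i⟩
  have harc : ∀ a b, σ.Arc a b ↔ ∃ i, a = w i ∧ b = w (i + 1) := by
    intro a b
    refine (hσa a b).trans ⟨?_, ?_⟩
    · rintro ⟨⟨i, rfl⟩, hab⟩
      exact ⟨i, rfl, Option.some.inj (hab.symm.trans (hw i))⟩
    · rintro ⟨i, rfl, rfl⟩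
      exact ⟨⟨i, rfl⟩, hw i⟩
  have hne : ∀ i j, i < j → w i ≠ w j := by
    intro i j hij he
    refine hc (hasCycle_iff.2 ⟨w i, j - i, by omega, ?_⟩)
    rw [iter_walk hw, show i + (j - i) = j by omega, ← he]
  refine ⟨σ, ⟨?_, harc⟩, hσ, fun x hx => ?_⟩
  · intro i j hij
    by_contra hn
    rcases lt_or_gt_of_ne hn with h | h
    · exact hne i j h hij
    · exact hne j i h hij.symm
  · have hx' : ∃ i, x = w i := by
      rcases hx with ⟨b, hb⟩ | ⟨b, hb⟩
      · obtain ⟨i, hi, -⟩ := (harc _ _).1 hb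
        exact ⟨_, hi⟩
      · obtain ⟨i, -, hi⟩ := (harc _ _).1 hb
        exact ⟨_, hi⟩
    obtain ⟨i, rfl⟩ := hx'
    refine ⟨fun hd => absurd ⟨_, hσw i⟩ hd, fun hi => ?_⟩
    cases i with
    | zero => exact h0
    | succ i => exact absurd ⟨_, hσw i⟩ hi

theorem MaxRightRay.arc {w : ℕ → X} (h : α.MaxRightRay w) (i : ℕ) : α.Arc (w i) (w (i + 1)) := by
  obtain ⟨σ, ⟨-, hw⟩, hσ, -⟩ := h
  exact hσ.arc ((hw _ _).2 ⟨i, rfl, rfl⟩)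

theorem MaxRightRay.injective {w : ℕ → X} (h : α.MaxRightRay w) : Function.Injective w := by
  obtain ⟨σ, hw, -⟩ := h
  exact hw.1

theorem hasMaxChain_of_iter {a z : X} {k : ℕ} (hk : (α ^ k : PTrans X) a = some z) (hk1 : 1 ≤ k)
    (ha : a ∉ α.im) (hz : α z = none) : α.HasMaxChain := by
  have hex : ∀ i, ∃ y, i ≤ k → (α ^ i : PTrans X) a = some y := by
    intro i
    by_cases hi : i ≤ k
    · obtain ⟨y, hy⟩ := iter_defined_of_le hk hi
      exact ⟨y, fun _ => hy⟩
    · exact ⟨a, fun h => absurd h hi⟩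
  choose c hc using hex
  have hc0 : c 0 = a := by
    have := hc 0 (Nat.zero_le _)
    rw [iter_zero] at this
    exact (Option.some.inj this).symm
  have hck : c k = z := Option.some.inj ((hc k le_rfl).symm.trans hk)
  have hca : ∀ i, i < k → α.Arc (c i) (c (i + 1)) := by
    intro i hi
    have h1 := hc (i + 1) hi
    rwa [iter_succ_last (hc i hi.le)] at h1
  -- If `c i = c j`, the orbit would reach `z` after `i + (k - j) < k` steps and stop there.
  have hne : ∀ i j, i < j → j ≤ k → c i ≠ c j := by
    intro i j hij hj he
    have h1 : (α ^ (i + (k - j)) : PTrans X) a = some z := by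
      rw [iter_add_of (hc i (by omega)), he, ← iter_add_of (hc j hj),
        show j + (k - j) = k by omega, hk]
    have h2 := iter_none_of_lt h1 hz (show i + (k - j) < k by omega)
    rw [hk] at h2
    exact absurd h2 (by simp)
  obtain ⟨σ, hσ, hσa⟩ := exists_restriction α {x | ∃ i, i < k ∧ x = c i}
  have hσc : ∀ i, i < k → σ.Arc (c i) (c (i + 1)) := fun i hi => (hσa _ _).2 ⟨⟨i, hi, rfl⟩, hca i hi⟩
  have harc : ∀ x y, σ.Arc x y ↔ ∃ i, i < k ∧ x = c i ∧ y = c (i + 1) := by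
    intro x y
    refine (hσa x y).trans ⟨?_, ?_⟩
    · rintro ⟨⟨i, hi, rfl⟩, hab⟩
      exact ⟨i, hi, rfl, Option.some.inj (hab.symm.trans (hca i hi))⟩
    · rintro ⟨i, hi, rfl, rfl⟩
      exact ⟨⟨i, hi, rfl⟩, hca i hi⟩
  refine ⟨σ, k, c, ⟨hk1, ?_, harc⟩, hσ, fun x hx => ?_⟩
  · intro i hi j hj hij
    by_contra hn
    rcases lt_or_gt_of_ne hn with h | h
    · exact hne i j h hj hij
    · exact hne j i h hi hij.symm
  · have hx' : ∃ i, i ≤ k ∧ x = c i := by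
      rcases hx with ⟨b, hb⟩ | ⟨b, hb⟩
      · obtain ⟨i, hi, h, -⟩ := (harc _ _).1 hb
        exact ⟨_, hi.le, h⟩
      · obtain ⟨i, hi, -, h⟩ := (harc _ _).1 hb
        exact ⟨_, hi, h⟩
    obtain ⟨i, hi, rfl⟩ := hx'
    refine ⟨fun hd => ?_, fun hm => ?_⟩
    · rcases hi.lt_or_eq with hlt | rfl
      · exact absurd ⟨_, hσc i hlt⟩ hd
      · rw [not_mem_dom_iff, hck, hz]
    · cases i with
      | zero => rwa [hc0]
      | succ i => exact absurd ⟨_, hσc i hi⟩ hm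

theorem exists_forward_walk (ht : ∀ x ∈ α.span, α x ≠ none) {a : X} (ha : a ∈ α.span) :
    ∃ u : ℕ → X, u 0 = a ∧ ∀ i, α.Arc (u i) (u (i + 1)) := by
  have hex : ∀ x, ∃ y, x ∈ α.span → α.Arc x y := by
    intro x
    by_cases hx : x ∈ α.span
    · obtain ⟨y, hy⟩ := Option.ne_none_iff_exists'.1 (ht x hx)
      exact ⟨y, fun _ => hy⟩
    · exact ⟨x, fun h => absurd h hx⟩
  choose s hs using hex
  have hmem : ∀ i, s^[i] a ∈ α.span := by
    intro i
    induction i with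
    | zero => exact ha
    | succ i ih => rw [Function.iterate_succ_apply']; exact (hs _ ih).right_mem
  exact ⟨fun i => s^[i] a, rfl, fun i => by
    beta_reduce
    rw [Function.iterate_succ_apply']; exact hs _ (hmem i)⟩

theorem hasDoubleRay_of_hasLeftRay (ht : ∀ x ∈ α.span, α x ≠ none) (hc : ¬ α.HasCycle)
    (hl : α.HasLeftRay) : α.HasDoubleRay := by
  obtain ⟨w, hw⟩ := hl.exists_walk
  obtain ⟨u, hu0, hu⟩ := exists_forward_walk ht (hw 0).right_mem
  -- The forward walk `u` occupies the indices `≥ 0` and `w (n + 1)` sits at index `-(n + 1)`; they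
  -- meet at `u 0 = w 0`.
  refine hasDoubleRay_of_walk hc (w := fun i => Int.casesOn i u fun n => w (n + 1)) fun i => ?_
  match i with
  | Int.ofNat n => exact hu n
  | Int.negSucc 0 =>
    have := hw 0
    rw [← hu0] at this
    exact this
  | Int.negSucc (n + 1) => exact hw (n + 1)

theorem exists_source (hwf : WellFounded α.Arc) (x : X) :
    ∃ a k, (α ^ k : PTrans X) a = some x ∧ a ∉ α.im := by
  induction x using hwf.induction with
  | _ x ih =>
    by_cases hx : x ∈ α.im
    · obtain ⟨y, hy⟩ := hx
      obtain ⟨a, k, hk, ha⟩ := ih y hy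
      exact ⟨a, k + 1, (iter_succ_last hk).trans hy, ha⟩
    · exact ⟨x, 0, iter_zero α x, hx⟩

/-! ### Types -/

/-- Without terminal vertices a left ray would extend to a double ray. So going backwards terminates
at a source, from which a maximal right ray starts, while a maximal chain would need a terminal end.
-/
theorem typeRro_of (hγ : γ.Connected) (ht : ∀ x ∈ γ.span, γ x ≠ none) (hc : ¬ γ.HasCycle)
    (hd : ¬ γ.HasDoubleRay) : γ.TypeRro := by
  have hl : ¬ γ.HasLeftRay := fun h => hd (hasDoubleRay_of_hasLeftRay ht hc h)
  refine ⟨hγ, ?_, hc, hd, hl, ?_⟩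
  · obtain ⟨x, hx⟩ : ∃ x, γ x ≠ none := by
      by_contra! h
      exact hγ.1 (funext h)
    obtain ⟨y, hy⟩ := Option.ne_none_iff_exists'.1 hx
    obtain ⟨a, k, hk, ha⟩ := exists_source (γ.wellFounded_arc hc hl) y
    have has : a ∈ γ.span := (joined_of_iter hk).symm.mem_span (Arc.right_mem hy)
    obtain ⟨u, rfl, hu⟩ := exists_forward_walk ht has
    exact ⟨u, maxRightRay_of_walk hc hu ha⟩
  · rintro ⟨σ, k, x, ⟨hk, hinj, harc⟩, hσ, hmax⟩
    have hm : x k ∈ σ.span :=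
      Or.inr ⟨x (k - 1), (harc _ _).2 ⟨k - 1, by omega, rfl, by rw [Nat.sub_add_cancel hk]⟩⟩
    have hnd : x k ∉ σ.dom := by
      rintro ⟨b, hb⟩
      obtain ⟨i, hi, he, -⟩ := (harc _ _).1 hb
      exact hi.ne (hinj hi.le (le_refl k) he.symm)
    have hms : x k ∈ γ.span := by
      obtain ⟨y, hy⟩ | ⟨y, hy⟩ := hm
      · exact (hσ.arc hy).left_mem
      · exact (hσ.arc hy).right_mem
    exact ht _ hms (not_mem_dom_iff.1 ((hmax _ hm).1 hnd))

/-- Everything flows into the root, so there is no infinite forward walk, which excludes cycles,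
right rays and double rays together. A left ray could be prolonged to the root and would become
maximal. -/
theorem typeCho_of (hγ : γ.Connected) {z : X} (hz : γ.IsRoot z) (hm : ¬ γ.HasMaxLeftRay) :
    γ.TypeCho := by
  have hz0 : γ z = none := not_mem_dom_iff.1 hz.2
  have hreach : ∀ x ∈ γ.span, ∃ k, (γ ^ k : PTrans X) x = some z := fun x hx =>
    (hγ.joined hx hz.1).iter_terminal hz0
  have hnwalk : ¬ ∃ w : ℕ → X, ∀ i, γ.Arc (w i) (w (i + 1)) := by
    rintro ⟨w, hw⟩
    obtain ⟨k, hk⟩ := hreach (w 0) (hw 0).left_mem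
    have h1 := iter_none_of_lt hk hz0 (Nat.lt_succ_self k)
    rw [iter_walk hw] at h1
    exact absurd h1 (by simp)
  have hc : ¬ γ.HasCycle := by
    intro h
    obtain ⟨x, n, hn, hx⟩ := hasCycle_iff.1 h
    obtain ⟨m, hm⟩ := exists_minPeriod hn hx
    choose c hc using hm.defined
    exact hnwalk ⟨c, fun i => (iter_succ_last (hc i)).symm.trans (hc (i + 1))⟩
  have hl : ¬ γ.HasLeftRay := by
    intro h
    obtain ⟨w, hw⟩ := h.exists_walk
    obtain ⟨k, hk⟩ := hreach (w 0) (hw 0).right_mem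
    exact hm (hasMaxLeftRay_of_reach hw hk hz0)
  refine ⟨hγ, ?_, hc, fun h => hnwalk h.exists_walk, ?_, hl⟩
  · obtain ⟨a, k, hk, ha⟩ := exists_source (γ.wellFounded_arc hc hl) z
    refine hasMaxChain_of_iter hk ?_ ha hz0
    by_contra h0
    obtain rfl : k = 0 := by omega
    rw [iter_zero] at hk
    rw [Option.some.inj hk] at ha
    exact hz.1.elim hz.2 ha
  · intro h
    obtain ⟨w, hw⟩ := h.exists_walk
    exact hnwalk ⟨fun n => w n, fun n => hw n⟩

theorem TypeRro.wellFounded (h : γ.TypeRro) : WellFounded γ.Arc :=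
  γ.wellFounded_arc h.2.2.1 h.2.2.2.2.1

theorem TypeCho.wellFounded (h : γ.TypeCho) : WellFounded γ.Arc :=
  γ.wellFounded_arc h.2.2.1 h.2.2.2.2.2

theorem HasMaxLeftRay.of_isComponent (h : γ.IsComponent α) (hm : γ.HasMaxLeftRay) :
    α.HasMaxLeftRay := by
  obtain ⟨w, hw, h0⟩ := hasMaxLeftRay_iff.1 hm
  exact hasMaxLeftRay_iff.2 ⟨w, fun i => h.containedIn.arc (hw i),
    by rw [← h.apply_eq (hw 0).right_mem, h0]⟩

/-! ### Ranks -/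

theorem rank_lt_rank (h : WellFounded γ.Arc) {x y : X} (hyx : γ.Arc y x) :
    γ.rank y < γ.rank x := by
  rw [rank, rank, dif_pos (h.apply y), dif_pos (h.apply x)]
  exact Acc.rank_lt_of_rel (h.apply x) hyx

theorem exists_arc_le_rank (h : WellFounded γ.Arc) {x : X} {o : Ordinal} (ho : o < γ.rank x) :
    ∃ y, γ.Arc y x ∧ o ≤ γ.rank y := by
  rw [rank, dif_pos (h.apply x), Acc.rank_eq, Ordinal.lt_iSup_iff] at ho
  obtain ⟨⟨y, hy⟩, ho⟩ := ho
  refine ⟨y, hy, ?_⟩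
  rw [rank, dif_pos (h.apply y)]
  exact Order.lt_succ_iff.1 ho

/-- Induction on `x`: a predecessor of `x` of rank at least `δ.rank (φ x)` would map to a
predecessor of `φ x` of at least that rank. Arcs need to be preserved only over the span of `δ`, so
that `δ` can be a single component of the target. -/
theorem rank_le_rank (hγ : WellFounded γ.Arc) (hδ : WellFounded δ.Arc) {φ : X → X}
    (hφ : ∀ x y, γ.Arc y x → φ x ∈ δ.span → δ.Arc (φ y) (φ x)) (x : X) (hx : φ x ∈ δ.span) :
    γ.rank x ≤ δ.rank (φ x) := by
  induction x using hγ.induction with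
  | _ x ih =>
    by_contra! hlt
    obtain ⟨y, hy, hle⟩ := exists_arc_le_rank hγ hlt
    have ha := hφ x y hy hx
    exact absurd (hle.trans (ih y hy ha.left_mem)) (not_le.2 (rank_lt_rank hδ ha))

/-! ### Homomorphisms preserving terminal vertices -/

/-- `φ` maps arcs of `α` to arcs of `β`, and terminal vertices in the span of `α` to points outside
the domain of `β`. -/
def IsRpHom (α β : PTrans X) (φ : X → X) : Prop :=
  (∀ x y, α.Arc x y → β.Arc (φ x) (φ y)) ∧ ∀ x ∈ α.span, α x = none → β (φ x) = none

/-- The same on the class of `r` only. -/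
def IsLocalHom (α β : PTrans X) (r : X) (φ : X → X) : Prop :=
  ∀ x, α.Joined r x →
    (∀ y, α.Arc x y → β.Arc (φ x) (φ y)) ∧ (α x = none → β (φ x) = none)

theorem IsLocalHom.of_joined {r s : X} {φ : X → X} (h : IsLocalHom α β r φ) (hrs : α.Joined r s) :
    IsLocalHom α β s φ :=
  fun x hx => h x (hrs.trans hx)

/-- Arcs stay inside a class, so local homomorphisms chosen at one representative per class glue
together. -/
theorem exists_isRpHom_of_local (h : ∀ r ∈ α.span, ∃ φ, IsLocalHom α β r φ) :
    ∃ φ, IsRpHom α β φ := by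
  let S : Setoid X := ⟨α.Joined, Joined.refl α, Joined.symm, Joined.trans⟩
  let rep : X → X := fun x => (Quotient.mk S x).out
  have hrep : ∀ x, α.Joined (rep x) x := fun x => Quotient.mk_out (s := S) x
  have hrep' : ∀ x y, α.Joined x y → rep x = rep y := fun x y hxy =>
    congrArg Quotient.out (Quotient.sound (s := S) hxy)
  have hex : ∀ r, ∃ φ : X → X, r ∈ α.span → IsLocalHom α β r φ := by
    intro r
    by_cases hr : r ∈ α.span
    · obtain ⟨φ, hφ⟩ := h r hr
      exact ⟨φ, fun _ => hφ⟩
    · exact ⟨id, fun h => absurd h hr⟩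
  choose Φ hΦ using hex
  have hloc : ∀ x ∈ α.span, IsLocalHom α β (rep x) (Φ (rep x)) := fun x hx =>
    hΦ _ ((hrep x).symm.mem_span hx)
  refine ⟨fun x => Φ (rep x) x, fun x y hxy => ?_, fun x hx h0 => (hloc x hx x (hrep x)).2 h0⟩
  beta_reduce
  rw [← hrep' x y (Arc.joined hxy)]
  exact (hloc x hxy.left_mem x (hrep x)).1 y hxy

/-- Given a relation `Z` that can be lifted along arcs backwards, a homomorphism from the forward
orbit of `r` to that of `y₀` which respects `Z` extends to the whole class of `r`. -/
theorem exists_isLocalHom {r y₀ : X} (Z : X → X → Prop)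
    (hZ : ∀ x y x', Z x y → α.Arc x' x → ∃ y', β.Arc y' y ∧ Z x' y')
    (hdef : ∀ n a, (α ^ n : PTrans X) r = some a → ∃ b, (β ^ n : PTrans X) y₀ = some b ∧ Z a b)
    (hnone : ∀ n a b, (α ^ n : PTrans X) r = some a → α a = none →
      (β ^ n : PTrans X) y₀ = some b → β b = none)
    (heq : ∀ n m a, (α ^ n : PTrans X) r = some a → (α ^ m : PTrans X) r = some a →
      (β ^ n : PTrans X) y₀ = (β ^ m : PTrans X) y₀) :
    ∃ φ, IsLocalHom α β r φ := by
  classical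
  -- The orbit of `r` may return to `a`; `heq` makes the image independent of the exponent `n`.
  have hbase : ∀ a, ∃ b, ∀ n, (α ^ n : PTrans X) r = some a →
      (β ^ n : PTrans X) y₀ = some b ∧ Z a b := by
    intro a
    by_cases h : ∃ n, (α ^ n : PTrans X) r = some a
    · obtain ⟨n, hn⟩ := h
      obtain ⟨b, hb, hab⟩ := hdef n a hn
      exact ⟨b, fun m hm => ⟨by rw [heq m n a hm hn, hb], hab⟩⟩
    · exact ⟨y₀, fun n hn => absurd ⟨n, hn⟩ h⟩
  choose f hf using hbase
  have hpred : ∀ x y x', ∃ y', Z x y → α.Arc x' x → β.Arc y' y ∧ Z x' y' := by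
    intro x y x'
    by_cases h : Z x y ∧ α.Arc x' x
    · obtain ⟨y', hy'⟩ := hZ x y x' h.1 h.2
      exact ⟨y', fun _ _ => hy'⟩
    · exact ⟨y₀, fun h1 h2 => absurd ⟨h1, h2⟩ h⟩
  choose p hp using hpred
  -- `D k x`: after `k` steps `x` is on the forward orbit of `r`. `F k x` is the image of such a
  -- point, obtained from `f` on the orbit by `k` backward lifts along `p`.
  let D : ℕ → X → Prop := fun k x =>
    ∃ m z, (α ^ k : PTrans X) x = some z ∧ (α ^ m : PTrans X) r = some z
  let F : ℕ → X → X := fun k => Nat.rec f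
    (fun _ g x => match α x with
      | none => x
      | some z => p z (g z) x) k
  have hF0 : ∀ x, F 0 x = f x := fun _ => rfl
  have hFs : ∀ k x z, α.Arc x z → F (k + 1) x = p z (F k z) x := by
    intro k x z hxz
    change (match α x with
      | none => x
      | some z => p z (F k z) x) = _
    rw [show α x = some z from hxz]
  have hD0 : ∀ x, D 0 x → ∃ m, (α ^ m : PTrans X) r = some x := by
    rintro x ⟨m, z, h1, h2⟩
    rw [iter_zero] at h1
    exact ⟨m, by rw [h2, h1]⟩
  have hDs : ∀ k x z, α.Arc x z → (D (k + 1) x ↔ D k z) := by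
    intro k x z hxz
    simp only [D, iter_succ_of hxz]
  have hinv : ∀ k x, D k x → (∀ j < k, ¬ D j x) → Z x (F k x) := by
    intro k
    induction k with
    | zero =>
      intro x hx _
      obtain ⟨m, hm⟩ := hD0 x hx
      exact (hf x m hm).2
    | succ k ih =>
      intro x hx hmin
      obtain ⟨m, z, h1, h2⟩ := id hx
      obtain ⟨x', hx', -⟩ := iter_of_iter_succ h1
      rw [hFs k x x' hx']
      refine (hp _ _ _ (ih x' ((hDs k x x' hx').1 hx) fun j hj hd => ?_) hx').2
      exact hmin (j + 1) (by omega) ((hDs j x x' hx').2 hd)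
  have hDex : ∀ x, α.Joined r x → ∃ k, D k x := by
    rintro x ⟨m, k, z, hm, hk⟩
    exact ⟨k, m, z, hk, hm⟩
  -- The least `k` is used, so orbit points take the value `f`, and the successor of a point at
  -- least distance `k + 1` has least distance `k`.
  let φ : X → X := fun x => if h : ∃ k, D k x then F (Nat.find h) x else x
  have hφ : ∀ k x, D k x → (∀ j < k, ¬ D j x) → φ x = F k x := by
    intro k x hk hmin
    have hex : ∃ k, D k x := ⟨k, hk⟩
    have : Nat.find hex = k := (Nat.find_eq_iff hex).2 ⟨hk, fun j hj => hmin j hj⟩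
    simp only [φ, dif_pos hex, this]
  refine ⟨φ, fun x hx => ?_⟩
  obtain ⟨k, hk, hmin⟩ : ∃ k, D k x ∧ ∀ j < k, ¬ D j x :=
    ⟨Nat.find (hDex x hx), Nat.find_spec (hDex x hx), fun j hj => Nat.find_min (hDex x hx) hj⟩
  rw [hφ k x hk hmin]
  cases k with
  | zero =>
    obtain ⟨m, hm⟩ := hD0 x hk
    have hb := (hf x m hm).1
    refine ⟨fun y hxy => ?_, fun h0 => hnone m x _ hm h0 hb⟩
    have hm' : (α ^ (m + 1) : PTrans X) r = some y := (iter_succ_last hm).trans hxy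
    have hb' := (hf y _ hm').1
    rw [hφ 0 y ⟨m + 1, y, iter_zero α y, hm'⟩ fun j hj => absurd hj (Nat.not_lt_zero j)]
    rw [iter_succ_last hb] at hb'
    exact hb'
  | succ k =>
    obtain ⟨m, z, h1, h2⟩ := id hk
    obtain ⟨x', hx', -⟩ := iter_of_iter_succ h1
    refine ⟨fun y hxy => ?_, fun h0 => absurd (h0.symm.trans hx') (Option.some_ne_none x').symm⟩
    have hy := (hDs k x y hxy).1 hk
    have hymin : ∀ j < k, ¬ D j y := fun j hj hd =>
      hmin (j + 1) (by omega) ((hDs j x y hxy).2 hd)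
    rw [hφ k y hy hymin, hFs k x y hxy]
    exact (hp _ _ _ (hinv k y hy hymin) hxy).1

/-! ### Conjugacy and homomorphisms -/

theorem exists_isRpHom_iff (hα : α ≠ 0) :
    (∃ g ∈ conjP1 α, α * g = g * β) ↔ ∃ φ, IsRpHom α β φ := by
  classical
  have mul_apply : ∀ (σ τ : PTrans X) x, (σ * τ) x = (σ x).bind τ := fun _ _ _ => rfl
  constructor
  · rintro ⟨g, hg, he⟩
    have he' : ∀ x, (α x).bind g = (g x).bind β := fun x => congrFun he x
    have him : ∀ x y, α.Arc x y → ∃ z, g y = some z := by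
      intro x y hxy
      rcases hg with (⟨h0, -⟩ | ⟨-, hg⟩) | rfl
      · exact absurd h0 hα
      · by_contra hn
        have hy : g y = none := by
          rcases h : g y with _ | z
          · rfl
          · exact absurd ⟨z, h⟩ hn
        -- With `m` the identity on `{x}`, the product `m * α` is the single arc from `x` to `y`,
        -- and it is killed by `g` if `g y` is undefined.
        obtain ⟨m, -, hm⟩ := exists_restriction (1 : PTrans X) {x}
        have hmx : m x = some x := (hm x x).2 ⟨rfl, rfl⟩
        have hma : ∀ a b, (m * α) a = some b → b = y := by
          intro a b hab
          rw [mul_apply] at hab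
          obtain ⟨c, hc, hcb⟩ := Option.bind_eq_some_iff.1 hab
          obtain ⟨rfl, h1⟩ := (hm a c).1 hc
          obtain rfl : a = c := Option.some.inj h1
          exact Option.some.inj (hcb.symm.trans hxy)
        refine hg m (fun h0 => ?_) (funext fun a => ?_)
        · have h1 := congrFun h0 x
          rw [mul_apply, hmx] at h1
          exact absurd (hxy.symm.trans h1) (Option.some_ne_none y)
        · rw [mul_apply]
          rcases h : (m * α) a with _ | b
          · rfl
          · rw [hma a b h]; exact hy
      · exact ⟨y, rfl⟩
    have harc : ∀ x y, α.Arc x y → ∃ a b, g x = some a ∧ g y = some b ∧ β.Arc a b := by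
      intro x y hxy
      obtain ⟨b, hb⟩ := him x y hxy
      have h1 := he' x
      rw [show α x = some y from hxy] at h1
      obtain ⟨a, ha, hab⟩ := Option.bind_eq_some_iff.1 (h1.symm.trans hb)
      exact ⟨a, b, ha, hb, hab⟩
    -- The default value is taken only outside the span of `α`, where nothing is required.
    refine ⟨fun x => (g x).getD x, fun x y hxy => ?_, fun x hx h0 => ?_⟩
    · obtain ⟨a, b, ha, hb, hab⟩ := harc x y hxy
      beta_reduce
      rw [ha, hb]
      exact hab
    · obtain ⟨a, ha⟩ : ∃ a, g x = some a := by
        rcases hx with ⟨y, hy⟩ | ⟨y, hy⟩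
        · obtain ⟨a, -, ha, -⟩ := harc _ _ hy
          exact ⟨a, ha⟩
        · exact him y x hy
      have h1 := he' x
      rw [h0, ha] at h1
      beta_reduce
      rw [ha]
      exact h1.symm
  · rintro ⟨φ, h1, h2⟩
    obtain ⟨g, hg, hg'⟩ : ∃ g : PTrans X,
        (∀ x ∈ α.span, g x = some (φ x)) ∧ ∀ x, x ∉ α.span → g x = none :=
      ⟨fun x => if x ∈ α.span then some (φ x) else none, fun x hx => if_pos hx,
        fun x hx => if_neg hx⟩
    refine ⟨g, Or.inl (Or.inr ⟨hα, fun m hm h0 => hm (funext fun a => ?_)⟩), funext fun x => ?_⟩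
    · have h3 := congrFun h0 a
      rw [mul_apply] at h3
      rcases h : (m * α) a with _ | b
      · rfl
      · rw [h] at h3
        rw [mul_apply] at h
        obtain ⟨c, -, hcb⟩ := Option.bind_eq_some_iff.1 h
        exact absurd ((hg b (Arc.right_mem (x := c) hcb)).symm.trans h3) (Option.some_ne_none _)
    · rw [mul_apply, mul_apply]
      by_cases hx : x ∈ α.span
      · rw [hg x hx]
        rcases h : α x with _ | y
        · exact (h2 x hx h).symm
        · exact (hg y (Arc.right_mem (x := x) h)).trans (h1 x y h).symm
      · rw [hg' x hx, not_mem_dom_iff.1 fun h => hx (Or.inl h)]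
        rfl

theorem conjC_iff (hα : α ≠ 0) (hβ : β ≠ 0) :
    ConjC α β ↔ (∃ φ, IsRpHom α β φ) ∧ ∃ φ, IsRpHom β α φ := by
  rw [← exists_isRpHom_iff hα, ← exists_isRpHom_iff hβ]
  constructor
  · rintro ⟨g, hg, h, hh, h1, h2⟩
    exact ⟨⟨g, hg, h1⟩, ⟨h, hh, h2⟩⟩
  · rintro ⟨⟨g, hg, h1⟩, ⟨h, hh, h2⟩⟩
    exact ⟨g, hg, h, hh, h1, h2⟩

/-- The equation `β * h = h * 0` makes `β * h` vanish, which membership in `conjP β` forbids for `β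
≠ 0` (take `m = 1`). -/
theorem eq_zero_of_conjC_zero (h : ConjC (0 : PTrans X) β) : β = 0 := by
  obtain ⟨g, -, h, (⟨h0, -⟩ | ⟨-, hh⟩) | rfl, -, h2⟩ := h
  · exact h0
  · by_contra hb
    refine hh 1 (by rwa [one_mul]) ?_
    rw [one_mul, h2, mul_zero]
  · rwa [mul_one, mul_zero] at h2

theorem conjC_symm (h : ConjC α β) : ConjC β α := by
  obtain ⟨g, hg, h, hh, h1, h2⟩ := h
  exact ⟨h, hh, g, hg, h2, h1⟩

/-! ### Consequences of a homomorphism -/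

theorem IsRpHom.iter {φ : X → X} (h : IsRpHom α β φ) {n : ℕ} {x z : X}
    (hx : (α ^ n : PTrans X) x = some z) : (β ^ n : PTrans X) (φ x) = some (φ z) := by
  induction n generalizing x with
  | zero => rw [iter_zero] at hx ⊢; rw [Option.some.inj hx]
  | succ n ih =>
    obtain ⟨y, hxy, hy⟩ := iter_of_iter_succ hx
    rw [iter_succ_of (h.1 x y hxy), ih hy]

theorem IsRpHom.hasCycle {φ : X → X} (h : IsRpHom α β φ) (hc : α.HasCycle) : β.HasCycle := by
  obtain ⟨x, n, hn, hx⟩ := hasCycle_iff.1 hc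
  exact hasCycle_iff.2 ⟨φ x, n, hn, h.iter hx⟩

theorem IsRpHom.exists_cycleLengths_dvd {φ : X → X} (h : IsRpHom α β φ) :
    ∀ n ∈ α.cycleLengths, ∃ m ∈ β.cycleLengths, m ∣ n := by
  intro n hn
  obtain ⟨x, hx⟩ := mem_cycleLengths_iff.1 hn
  have hb := h.iter hx.2.1
  obtain ⟨m, hm⟩ := exists_minPeriod hx.1 hb
  refine ⟨m, mem_cycleLengths_iff.2 ⟨_, hm⟩, Nat.dvd_of_mod_eq_zero ?_⟩
  rw [hm.mod_eq (hb.trans (iter_zero β (φ x)).symm), Nat.zero_mod]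

theorem IsRpHom.hasDoubleRay {φ : X → X} (h : IsRpHom α β φ) (hc : ¬ β.HasCycle)
    (hd : α.HasDoubleRay) : β.HasDoubleRay := by
  obtain ⟨w, hw⟩ := hd.exists_walk
  exact hasDoubleRay_of_walk hc (w := fun i => φ (w i)) fun i => h.1 _ _ (hw i)

theorem IsRpHom.hasMaxLeftRay {φ : X → X} (h : IsRpHom α β φ) (hm : α.HasMaxLeftRay) :
    β.HasMaxLeftRay := by
  obtain ⟨w, hw, h0⟩ := hasMaxLeftRay_iff.1 hm
  exact hasMaxLeftRay_iff.2
    ⟨fun i => φ (w i), fun i => h.1 _ _ (hw i), h.2 _ (hw 0).right_mem h0⟩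

theorem IsRpHom.rank_le {φ : X → X} (h : IsRpHom α β φ) (hγ : γ.IsComponent α)
    (hδ : δ.IsComponent β) (hγw : WellFounded γ.Arc) (hδw : WellFounded δ.Arc) {x : X}
    (hx : φ x ∈ δ.span) : γ.rank x ≤ δ.rank (φ x) :=
  rank_le_rank hγw hδw
    (fun _ _ hyx hs => hδ.arc_of_right hs (h.1 _ _ (hγ.containedIn.arc hyx))) x hx

/-- The image of a maximal right ray is an infinite walk, so the component containing it has no
terminal vertex and is of type rro. -/
theorem IsRpHom.exists_dominates {φ : X → X} (h : IsRpHom α β φ) (hc : ¬ β.HasCycle)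
    (hd : ¬ β.HasDoubleRay) (hγ : γ.IsComponent α) (hγt : γ.TypeRro) :
    ∃ δ : PTrans X, δ.IsComponent β ∧ δ.TypeRro ∧
      ∃ x y : ℕ → X, γ.MaxRightRay x ∧ δ.MaxRightRay y ∧
        Dominates (fun n => δ.rank (y n)) (fun n => γ.rank (x n)) := by
  obtain ⟨x, hx⟩ := hγt.2.1
  have hβ : ∀ i, β.Arc (φ (x i)) (φ (x (i + 1))) := fun i =>
    h.1 _ _ (hγ.containedIn.arc (hx.arc i))
  obtain ⟨δ, hδ, h0⟩ := exists_isComponent (hβ 0).left_mem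
  have hmem : ∀ i, φ (x i) ∈ δ.span := by
    intro i
    induction i with
    | zero => exact h0
    | succ i ih => exact (hδ.arc_of_left ih (hβ i)).right_mem
  have hδx : ∀ i, δ.Arc (φ (x i)) (φ (x (i + 1))) := fun i => hδ.arc_of_left (hmem i) (hβ i)
  have ht : ∀ z ∈ δ.span, δ z ≠ none := by
    intro z hz hz0
    obtain ⟨k, hk⟩ := (hδ.connected.joined h0 hz).iter_terminal hz0
    have h1 := iter_none_of_lt hk hz0 (Nat.lt_succ_self k)
    rw [iter_walk (w := fun i => φ (x i)) hδx 0] at h1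
    exact absurd h1 (Option.some_ne_none _)
  have hδc : ¬ δ.HasCycle := fun hh => hc (hh.mono hδ.containedIn)
  have hδt : δ.TypeRro :=
    typeRro_of hδ.connected ht hδc fun hh => hd (hh.mono hδ.containedIn)
  -- The image walk need not start at a source; prolonging it backwards by `k` steps makes it
  -- maximal, and `k` is the shift in the domination.
  obtain ⟨a, k, hk, ha⟩ := exists_source hδt.wellFounded (φ (x 0))
  obtain ⟨u, rfl, hu⟩ := exists_forward_walk ht ((joined_of_iter hk).symm.mem_span h0)
  have huk : ∀ n, u (k + n) = φ (x n) := by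
    intro n
    have h1 := iter_walk hu 0 (k + n)
    rw [iter_add_of hk, iter_walk (w := fun i => φ (x i)) hδx 0, Nat.zero_add, Nat.zero_add] at h1
    exact (Option.some.inj h1).symm
  refine ⟨δ, hδ, hδt, x, u, hx, maxRightRay_of_walk hδc hu ha, k, fun n => ?_⟩
  beta_reduce
  rw [huk]
  exact h.rank_le hγ hδ hγt.wellFounded hδt.wellFounded (hmem n)

theorem IsRpHom.exists_root_rank_le {φ : X → X} (h : IsRpHom α β φ) (hm : ¬ β.HasMaxLeftRay)
    (hγ : γ.IsComponent α) (hγt : γ.TypeCho) {x₀ : X} (hx : γ.IsRoot x₀) :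
    ∃ (δ : PTrans X) (y₀ : X), δ.IsComponent β ∧ δ.TypeCho ∧ δ.IsRoot y₀ ∧
      γ.rank x₀ ≤ δ.rank y₀ := by
  have hx0 : α x₀ = none := by rw [← hγ.apply_eq hx.1, not_mem_dom_iff.1 hx.2]
  obtain ⟨y, hy⟩ : x₀ ∈ γ.im := hx.1.resolve_left hx.2
  have hβ := h.1 _ _ (hγ.containedIn.arc hy)
  obtain ⟨δ, hδ, h0⟩ := exists_isComponent hβ.right_mem
  have hr : δ.IsRoot (φ x₀) := by
    refine ⟨h0, not_mem_dom_iff.2 ?_⟩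
    rw [hδ.apply_eq h0]
    exact h.2 x₀ (hγ.span_subset hx.1) hx0
  have hδt := typeCho_of hδ.connected hr fun hh => hm (hh.of_isComponent hδ)
  exact ⟨δ, φ x₀, hδ, hδt, hr, h.rank_le hγ hδ hγt.wellFounded hδt.wellFounded h0⟩

/-! ### Construction of homomorphisms -/

theorem exists_isLocalHom_of_terminal_leftRay {z : X} (hz : α z = none) (hm : β.HasMaxLeftRay) :
    ∃ φ, IsLocalHom α β z φ := by
  obtain ⟨w, hw, h0⟩ := hasMaxLeftRay_iff.1 hm
  have hn : ∀ n a, (α ^ n : PTrans X) z = some a → n = 0 := by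
    intro n a h
    cases n with
    | zero => rfl
    | succ n => rw [iter_succ_none hz] at h; exact absurd h.symm (Option.some_ne_none a)
  refine exists_isLocalHom (y₀ := w 0) (fun _ y => y ∈ Set.range w) ?_ ?_ ?_ ?_
  · rintro x _ x' ⟨i, rfl⟩ -
    exact ⟨w (i + 1), hw i, i + 1, rfl⟩
  · intro n a h
    rw [hn n a h]
    exact ⟨w 0, iter_zero β _, 0, rfl⟩
  · intro n a b h _ hb
    rw [hn n a h, iter_zero] at hb
    rw [← Option.some.inj hb, h0]
  · intro n m a h h'
    rw [hn n a h, hn m a h']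

/-- Since `γ.rank x' < γ.rank x ≤ δ.rank y`, some predecessor of `y` has rank at least `γ.rank x'`.
This is the lifting hypothesis of `exists_isLocalHom` for targets of type rro or cho. -/
theorem exists_arc_of_rank_le (hγ : γ.IsComponent α) (hδ : δ.IsComponent β)
    (hγw : WellFounded γ.Arc) (hδw : WellFounded δ.Arc) (x y x' : X)
    (h : x ∈ γ.span ∧ y ∈ δ.span ∧ γ.rank x ≤ δ.rank y) (hx' : α.Arc x' x) :
    ∃ y', β.Arc y' y ∧ x' ∈ γ.span ∧ y' ∈ δ.span ∧ γ.rank x' ≤ δ.rank y' := by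
  have ha := hγ.arc_of_right h.1 hx'
  obtain ⟨y', hy', hle⟩ := exists_arc_le_rank hδw ((rank_lt_rank hγw ha).trans_le h.2.2)
  exact ⟨y', hδ.containedIn.arc hy', ha.left_mem, hy'.left_mem, hle⟩

theorem exists_isLocalHom_of_root (hγ : γ.IsComponent α) (hδ : δ.IsComponent β)
    (hγt : γ.TypeCho) (hδt : δ.TypeCho) {x₀ y₀ : X} (hx : γ.IsRoot x₀) (hy : δ.IsRoot y₀)
    (hle : γ.rank x₀ ≤ δ.rank y₀) : ∃ φ, IsLocalHom α β x₀ φ := by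
  have hx0 : α x₀ = none := by rw [← hγ.apply_eq hx.1, not_mem_dom_iff.1 hx.2]
  have hy0 : β y₀ = none := by rw [← hδ.apply_eq hy.1, not_mem_dom_iff.1 hy.2]
  have hn : ∀ n a, (α ^ n : PTrans X) x₀ = some a → n = 0 ∧ a = x₀ := by
    intro n a h
    cases n with
    | zero => rw [iter_zero] at h; exact ⟨rfl, (Option.some.inj h).symm⟩
    | succ n => rw [iter_succ_none hx0] at h; exact absurd h.symm (Option.some_ne_none a)
  refine exists_isLocalHom (y₀ := y₀) _
    (exists_arc_of_rank_le hγ hδ hγt.wellFounded hδt.wellFounded) ?_ ?_ ?_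
  · intro n a h
    obtain ⟨rfl, rfl⟩ := hn n a h
    exact ⟨y₀, iter_zero β _, hx.1, hy.1, hle⟩
  · intro n a b h _ hb
    rw [(hn n a h).1, iter_zero] at hb
    rw [← Option.some.inj hb, hy0]
  · intro n m a h h'
    rw [(hn n a h).1, (hn m a h').1]

theorem exists_isLocalHom_of_dominates (hγ : γ.IsComponent α) (hδ : δ.IsComponent β)
    (hγt : γ.TypeRro) (hδt : δ.TypeRro) {x y : ℕ → X} (hx : γ.MaxRightRay x)
    (hy : δ.MaxRightRay y) (hdom : Dominates (fun n => δ.rank (y n)) (fun n => γ.rank (x n))) :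
    ∃ φ, IsLocalHom α β (x 0) φ := by
  obtain ⟨k, hk⟩ := hdom
  have hαx : ∀ n, (α ^ n : PTrans X) (x 0) = some (x n) := fun n => by
    rw [iter_walk fun i => hγ.containedIn.arc (hx.arc i), Nat.zero_add]
  have hβy : ∀ n, (β ^ n : PTrans X) (y k) = some (y (k + n)) := fun n =>
    iter_walk (fun i => hδ.containedIn.arc (hy.arc i)) k n
  -- The ray is sent along `x n ↦ y (k + n)`, with `k` the shift from the domination.
  refine exists_isLocalHom (y₀ := y k) _
    (exists_arc_of_rank_le hγ hδ hγt.wellFounded hδt.wellFounded) ?_ ?_ ?_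
  · intro n a h
    obtain rfl : x n = a := Option.some.inj ((hαx n).symm.trans h)
    exact ⟨_, hβy n, (hx.arc n).left_mem, (hy.arc _).left_mem, hk n⟩
  · intro n a b h h0 _
    obtain rfl : x n = a := Option.some.inj ((hαx n).symm.trans h)
    exact absurd ((hγ.containedIn.arc (hx.arc n)).symm.trans h0) (Option.some_ne_none _)
  · intro n m a h h'
    rw [hαx] at h h'
    rw [hx.injective (Option.some.inj (h.trans h'.symm))]

/-- The class is wrapped around the cycle of `y`. The congruence modulo `m` covers both a base point
on a cycle of length divisible by `m` and an orbit without repetition. -/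
theorem exists_isLocalHom_of_minPeriod {r y : X} {m : ℕ} (hy : β.MinPeriod m y)
    (ht : ∀ x, α.Joined r x → α x ≠ none)
    (heq : ∀ i j a, (α ^ i : PTrans X) r = some a → (α ^ j : PTrans X) r = some a →
      i % m = j % m) : ∃ φ, IsLocalHom α β r φ := by
  refine exists_isLocalHom (y₀ := y) (fun _ b => ∃ i, (β ^ i : PTrans X) y = some b) ?_ ?_ ?_ ?_
  · rintro x b x' ⟨i, hi⟩ -
    -- The predecessor on the cycle has index `i - 1` modulo `m`; adding `m` avoids truncated
    -- subtraction at `i = 0`.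
    obtain ⟨c, hc⟩ := hy.defined (i + m - 1)
    refine ⟨c, ?_, i + m - 1, hc⟩
    have hm := hy.1
    have h1 := iter_succ_last hc
    rw [show i + m - 1 + 1 = i + m by omega, iter_mod_of_period hy.2.1, Nat.add_mod_right,
      ← iter_mod_of_period hy.2.1, hi] at h1
    exact h1.symm
  · intro n a _
    obtain ⟨b, hb⟩ := hy.defined n
    exact ⟨b, hb, n, hb⟩
  · intro n a b h h0 _
    exact absurd h0 (ht a (joined_of_iter h))
  · intro i j a hi hj
    rw [iter_mod_of_period hy.2.1 i, iter_mod_of_period hy.2.1 j, heq i j a hi hj]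

theorem iter_index_unique {r : X}
    (hc : ∀ x, α.Joined r x → ∀ n, 1 ≤ n → (α ^ n : PTrans X) x ≠ some x) {i j : ℕ} {a : X}
    (hi : (α ^ i : PTrans X) r = some a) (hj : (α ^ j : PTrans X) r = some a) : i = j := by
  have key : ∀ i j, i < j → (α ^ i : PTrans X) r = some a → (α ^ j : PTrans X) r ≠ some a := by
    intro i j hij hi hj
    refine hc a (joined_of_iter hi) (j - i) (by omega) ?_
    rw [← iter_add_of hi, show i + (j - i) = j by omega, hj]
  rcases Nat.lt_trichotomy i j with h | h | h
  · exact absurd hj (key i j h hi)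
  · exact h
  · exact absurd hi (key j i h hj)

theorem exists_isLocalHom_of_doubleRay {r : X} (hd : β.HasDoubleRay)
    (ht : ∀ x, α.Joined r x → α x ≠ none)
    (hc : ∀ x, α.Joined r x → ∀ n, 1 ≤ n → (α ^ n : PTrans X) x ≠ some x) :
    ∃ φ, IsLocalHom α β r φ := by
  obtain ⟨w, hw⟩ := hd.exists_walk
  refine exists_isLocalHom (y₀ := w 0) (fun _ b => b ∈ Set.range w) ?_ ?_ ?_ ?_
  · rintro x _ x' ⟨i, rfl⟩ -
    refine ⟨w (i - 1), ?_, i - 1, rfl⟩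
    have := hw (i - 1)
    rwa [sub_add_cancel] at this
  · intro n a _
    exact ⟨w n, by simpa using iter_walk (α := β) (w := fun n : ℕ => w n) (fun n => hw n) 0 n,
      n, rfl⟩
  · intro n a b h h0 _
    exact absurd h0 (ht a (joined_of_iter h))
  · intro i j a hi hj
    rw [iter_index_unique hc hi hj]

/-- Sufficiency of the conditions for the existence of a homomorphism from `α` to `β`. -/
theorem exists_isRpHom_of_conditions (hcs : α.cycleSet = β.cycleSet)
    (hdr : α.HasDoubleRay ∧ ¬ α.HasCycle → β.HasDoubleRay ∧ ¬ β.HasCycle)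
    (hrro : ∀ γ : PTrans X, γ.IsComponent α → γ.TypeRro → ¬ α.HasCycle → ¬ α.HasDoubleRay →
      ∃ δ : PTrans X, δ.IsComponent β ∧ δ.TypeRro ∧
        ∃ x y : ℕ → X, γ.MaxRightRay x ∧ δ.MaxRightRay y ∧
          Dominates (fun n => δ.rank (y n)) (fun n => γ.rank (x n)))
    (hml : α.HasMaxLeftRay → β.HasMaxLeftRay)
    (hcho : ∀ (γ : PTrans X) (x₀ : X), γ.IsComponent α → γ.TypeCho → γ.IsRoot x₀ →
      ¬ α.HasMaxLeftRay →
      ∃ (δ : PTrans X) (y₀ : X), δ.IsComponent β ∧ δ.TypeCho ∧ δ.IsRoot y₀ ∧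
        γ.rank x₀ ≤ δ.rank y₀) :
    ∃ φ, IsRpHom α β φ := by
  have hdvd : ∀ n ∈ α.cycleLengths, ∃ m ∈ β.cycleLengths, m ∣ n := by
    intro n hn
    obtain ⟨m, hm, hmn⟩ := exists_mem_standardAntichain hn
    have hm' : m ∈ β.cycleSet := hcs ▸ hm
    exact ⟨m, hm'.1, hmn⟩
  refine exists_isRpHom_of_local fun r hr => ?_
  obtain ⟨γ, hγ, hrγ⟩ := exists_isComponent hr
  by_cases hter : ∃ z, α.Joined r z ∧ α z = none
  · obtain ⟨z, hrz, hz⟩ := hter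
    -- Based at the terminal vertex, the forward orbit is a single point.
    suffices h : ∃ φ, IsLocalHom α β z φ by
      obtain ⟨φ, hφ⟩ := h
      exact ⟨φ, hφ.of_joined hrz.symm⟩
    by_cases hβ : β.HasMaxLeftRay
    · exact exists_isLocalHom_of_terminal_leftRay hz hβ
    · have hα : ¬ α.HasMaxLeftRay := fun h => hβ (hml h)
      obtain ⟨γ, hγ, hzγ⟩ := exists_isComponent (hrz.mem_span hr)
      have hroot : γ.IsRoot z :=
        ⟨hzγ, not_mem_dom_iff.2 (by rw [hγ.apply_eq hzγ, hz])⟩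
      have hγt := typeCho_of hγ.connected hroot fun h => hα (h.of_isComponent hγ)
      obtain ⟨δ, y₀, hδ, hδt, hy, hle⟩ := hcho γ z hγ hγt hroot hα
      exact exists_isLocalHom_of_root hγ hδ hγt hδt hroot hy hle
  have ht : ∀ x, α.Joined r x → α x ≠ none := fun x hx h0 => hter ⟨x, hx, h0⟩
  by_cases hcyc : ∃ x n, α.Joined r x ∧ 1 ≤ n ∧ (α ^ n : PTrans X) x = some x
  · obtain ⟨x, n, hrx, hn, hx⟩ := hcyc
    obtain ⟨n, hn⟩ := exists_minPeriod hn hx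
    obtain ⟨m, hm, hmn⟩ := hdvd n (mem_cycleLengths_iff.2 ⟨x, hn⟩)
    obtain ⟨y, hy⟩ := mem_cycleLengths_iff.1 hm
    obtain ⟨φ, hφ⟩ := exists_isLocalHom_of_minPeriod hy (fun z hz => ht z (hrx.trans hz))
      fun i j a hi hj => (show i ≡ j [MOD m] from
        Nat.ModEq.of_dvd hmn (hn.mod_eq (hi.trans hj.symm)))
    exact ⟨φ, hφ.of_joined hrx.symm⟩
  have hc : ∀ x, α.Joined r x → ∀ n, 1 ≤ n → (α ^ n : PTrans X) x ≠ some x :=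
    fun x hx n hn h => hcyc ⟨x, n, hx, hn, h⟩
  by_cases hβc : β.HasCycle
  · obtain ⟨m, hm⟩ := hasCycle_iff_nonempty.1 hβc
    obtain ⟨y, hy⟩ := mem_cycleLengths_iff.1 hm
    exact exists_isLocalHom_of_minPeriod hy ht fun i j a hi hj => by
      rw [iter_index_unique hc hi hj]
  by_cases hβd : β.HasDoubleRay
  · exact exists_isLocalHom_of_doubleRay hβd ht hc
  -- Now `β` has neither cycles nor double rays; the first two conditions pass this to `α`, so the
  -- component of `r` is of type rro.
  have hαc : ¬ α.HasCycle := by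
    intro h
    obtain ⟨n, hn⟩ := hasCycle_iff_nonempty.1 h
    obtain ⟨m, hm, -⟩ := hdvd n hn
    exact hβc (hasCycle_iff_nonempty.2 ⟨m, hm⟩)
  have hαd : ¬ α.HasDoubleRay := fun h => hβd (hdr ⟨h, hαc⟩).1
  have hjoin : ∀ x ∈ γ.span, α.Joined r x := fun x hx =>
    hγ.containedIn.joined (hγ.connected.joined hrγ hx)
  have hγt : γ.TypeRro := typeRro_of hγ.connected
    (fun x hx => by rw [hγ.apply_eq hx]; exact ht x (hjoin x hx))
    (fun h => hαc (h.mono hγ.containedIn)) fun h => hαd (h.mono hγ.containedIn)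
  obtain ⟨δ, hδ, hδt, x, y, hx, hy, hdom⟩ := hrro γ hγ hγt hαc hαd
  obtain ⟨φ, hφ⟩ := exists_isLocalHom_of_dominates hγ hδ hγt hδt hx hy hdom
  exact ⟨φ, hφ.of_joined (hjoin _ (hx.arc 0).left_mem).symm⟩

theorem cycleSet_subset_of_isRpHom {φ ψ : X → X} (hφ : IsRpHom α β φ) (hψ : IsRpHom β α ψ) :
    α.cycleSet ⊆ β.cycleSet :=
  standardAntichain_subset (fun _ hn => hn.1) hφ.exists_cycleLengths_dvd
    hψ.exists_cycleLengths_dvd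

theorem hasDoubleRay_and_not_hasCycle {φ ψ : X → X} (hφ : IsRpHom α β φ) (hψ : IsRpHom β α ψ)
    (h : α.HasDoubleRay ∧ ¬ α.HasCycle) : β.HasDoubleRay ∧ ¬ β.HasCycle :=
  have hc : ¬ β.HasCycle := fun hh => h.2 (hψ.hasCycle hh)
  ⟨hφ.hasDoubleRay hc h.1, hc⟩

end PTrans

/-! ### The characterization of conjugacy -/

open PTrans in
theorem theorem5p3 {X : Type*} (α β : PTrans X) :
    ConjC α β ↔
      (α = 0 ∧ β = 0) ∨
      (α ≠ 0 ∧ β ≠ 0 ∧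
        α.cycleSet = β.cycleSet ∧
        ((α.HasDoubleRay ∧ ¬ α.HasCycle) ↔ (β.HasDoubleRay ∧ ¬ β.HasCycle)) ∧
        (∀ γ : PTrans X, γ.IsComponent α → γ.TypeRro → ¬ α.HasCycle → ¬ α.HasDoubleRay →
          ¬ β.HasCycle ∧ ¬ β.HasDoubleRay ∧
          ∃ δ : PTrans X, δ.IsComponent β ∧ δ.TypeRro ∧
            ∃ x y : ℕ → X, γ.MaxRightRay x ∧ δ.MaxRightRay y ∧
              Dominates (fun n => δ.rank (y n)) (fun n => γ.rank (x n))) ∧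
        (∀ δ : PTrans X, δ.IsComponent β → δ.TypeRro → ¬ β.HasCycle → ¬ β.HasDoubleRay →
          ¬ α.HasCycle ∧ ¬ α.HasDoubleRay ∧
          ∃ γ : PTrans X, γ.IsComponent α ∧ γ.TypeRro ∧
            ∃ x y : ℕ → X, γ.MaxRightRay x ∧ δ.MaxRightRay y ∧
              Dominates (fun n => γ.rank (x n)) (fun n => δ.rank (y n))) ∧
        (α.HasMaxLeftRay ↔ β.HasMaxLeftRay) ∧
        (∀ (γ : PTrans X) (x₀ : X), γ.IsComponent α → γ.TypeCho → γ.IsRoot x₀ →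
          ¬ α.HasMaxLeftRay →
          ¬ β.HasMaxLeftRay ∧
          ∃ (δ : PTrans X) (y₀ : X), δ.IsComponent β ∧ δ.TypeCho ∧ δ.IsRoot y₀ ∧
            γ.rank x₀ ≤ δ.rank y₀) ∧
        (∀ (δ : PTrans X) (y₀ : X), δ.IsComponent β → δ.TypeCho → δ.IsRoot y₀ →
          ¬ β.HasMaxLeftRay →
          ¬ α.HasMaxLeftRay ∧
          ∃ (γ : PTrans X) (x₀ : X), γ.IsComponent α ∧ γ.TypeCho ∧ γ.IsRoot x₀ ∧
            δ.rank y₀ ≤ γ.rank x₀)) := by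

  by_cases hα : α = 0
  · subst hα
    refine ⟨fun h => Or.inl ⟨rfl, eq_zero_of_conjC_zero h⟩, ?_⟩
    rintro (⟨-, rfl⟩ | ⟨h, -⟩)
    · exact ⟨1, Or.inr rfl, 1, Or.inr rfl, rfl, rfl⟩
    · exact absurd rfl h
  by_cases hβ : β = 0
  · subst hβ
    refine ⟨fun h => absurd (eq_zero_of_conjC_zero (conjC_symm h)) hα, ?_⟩
    rintro (⟨h, -⟩ | ⟨-, h, -⟩)
    · exact absurd h hα
    · exact absurd rfl h
  rw [conjC_iff hα hβ]
  constructor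
  · rintro ⟨⟨φ, hφ⟩, ψ, hψ⟩
    refine Or.inr ⟨hα, hβ,
      (cycleSet_subset_of_isRpHom hφ hψ).antisymm (cycleSet_subset_of_isRpHom hψ hφ),
      ⟨hasDoubleRay_and_not_hasCycle hφ hψ, hasDoubleRay_and_not_hasCycle hψ hφ⟩, ?_, ?_,
      ⟨hφ.hasMaxLeftRay, hψ.hasMaxLeftRay⟩, ?_, ?_⟩
    · intro γ hγ hγt hc hd
      have hc' : ¬ β.HasCycle := fun h => hc (hψ.hasCycle h)
      have hd' : ¬ β.HasDoubleRay := fun h => hd (hψ.hasDoubleRay hc h)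
      exact ⟨hc', hd', hφ.exists_dominates hc' hd' hγ hγt⟩
    · intro δ hδ hδt hc hd
      have hc' : ¬ α.HasCycle := fun h => hc (hφ.hasCycle h)
      have hd' : ¬ α.HasDoubleRay := fun h => hd (hφ.hasDoubleRay hc h)
      obtain ⟨γ, hγ, hγt, x, y, hx, hy, hdom⟩ := hψ.exists_dominates hc' hd' hδ hδt
      exact ⟨hc', hd', γ, hγ, hγt, y, x, hy, hx, hdom⟩
    · intro γ x₀ hγ hγt hx hm
      have hm' : ¬ β.HasMaxLeftRay := fun h => hm (hψ.hasMaxLeftRay h)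
      exact ⟨hm', hφ.exists_root_rank_le hm' hγ hγt hx⟩
    · intro δ y₀ hδ hδt hy hm
      have hm' : ¬ α.HasMaxLeftRay := fun h => hm (hφ.hasMaxLeftRay h)
      exact ⟨hm', hψ.exists_root_rank_le hm' hδ hδt hy⟩
  · rintro (⟨h, -⟩ | ⟨-, -, hcs, hdr, h3, h3', hml, h5, h5'⟩)
    · exact absurd h hα
    · refine ⟨exists_isRpHom_of_conditions hcs hdr.1
          (fun γ hγ hγt hc hd => (h3 γ hγ hγt hc hd).2.2) hml.1
          (fun γ x hγ hγt hx hm => (h5 γ x hγ hγt hx hm).2),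
        exists_isRpHom_of_conditions hcs.symm hdr.2 (fun δ hδ hδt hc hd => ?_) hml.2
          (fun δ y hδ hδt hy hm => (h5' δ y hδ hδt hy hm).2)⟩
      obtain ⟨-, -, γ, hγ, hγt, x, y, hx, hy, hdom⟩ := h3' δ hδ hδt hc hd
      exact ⟨γ, hγ, hγt, y, x, hy, hx, hdom⟩
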